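/- Conventions. A ranked set is a finite set with a rank function into $\mathbb N$. Fix a ranked set $\Sigma$ of edge labels. A graph over $\Sigma$ is a finite hypergraph with edges labelled in $\Sigma$ (an edge labelled $a$ is attached to a sequence of $\mathrm{rank}(a)$ nodes), together with two repetition-free node sequences, its front and its rear interface; it has type $(m,n)$ if these have lengths $m$ and $n$. $\mathbb G^{(m,n)}$ is the set of graphs of type $(m,n)$, and $\mathbb G^m=\bigcup_n\mathbb G^{(m,n)}$. Node and edge names are taken from fixed infinite sets. A graph $P$ is a frontal subgraph of $H$ if its nodes and edges (with labels and attachments) belong to $H$, $\mathrm{front}_P=\mathrm{front}_H$, and every node of $P$ in $\mathrm{rear}_H$ is in $\mathrm{rear}_P$. Then $H\oslash P$ is obtained from $H$ by deleting all nodes of $P$ not in $\mathrm{rear}_P$, all edges of $P$ and all edges attached to a deleted node; its front is $\mathrm{rear}_P$ and its rear is $\mathrm{rear}_H$. Evaluation. Let $E$ be a finite directed graph whose nodes are classified as universal or existential. A partial truth assignment $\alpha$ on the nodes evolves into $\alpha'$, where a universal node becomes true if all its successors are true under $\alpha$ and false if some successor is false; an existential node becomes false if all its successors are false and true if some successor is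 true; otherwise $\alpha'(c)=\alpha(c)$. Let $\alpha_E^*$ be the fixed point reached by iterating this from the everywhere undefined assignment (the smallest fixed point with respect to extension of partial assignments). Automata. An alternating graph automaton $\mathcal A$ over $\Sigma$ consists of a ranked set $Q$ of states, an initial state $q_0\in Q$, a set of universal states (the others are existential), and a finite set $\Delta$ of transitions $(q,\Gamma,q')$ with $q,q'\in Q$ and $\Gamma\in\mathbb G^{(\mathrm{rank}(q),\mathrm{rank}(q'))}$. A configuration is a pair $(q,G)$ with $G\in\mathbb G^{\mathrm{rank}(q)}$, universal iff $q$ is; there is a step from $(q,G)$ to $(q',G\oslash P)$ for each $(q,\Gamma,q')\in\Delta$ and each frontal subgraph $P\cong\Gamma$ of $G$. For $G_0\in\mathbb G^{\mathrm{rank}(q_0)}$ let $K$ be the graph of all configurations reachable from $(q_0,G_0)$, with the steps as edges. The lower language $\underline L(\mathcal A)$ is the set of $G_0\in\mathbb G^{\mathrm{rank}(q_0)}$ with $\alpha_K^*(q_0,G_0)=\mathit{true}$; the upper language $\overline L(\mathcal A)$ is the set of those for which $\alpha_K^*(q_0,G_0)$ is not $\mathit{false}$ (true or undefined). Formula systems.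 Graph expressions are built, with the obvious typing, from $\varnothing$ and single graphs (up to isomorphism) by union, concatenation (gluing the rear of the first graph to the front of the second) and Kleene star (iterated concatenation, including the identity graph: the edgeless graph with equal front and rear interfaces containing all its nodes); an expression $e$ of type $(i,j)$ denotes a language $L(e)\subseteq\mathbb G^{(i,j)}$. For a ranked set $X$ of variables, formulas of type $m$ are: $\mathit{true}$, $\mathit{false}$; variables of rank $m$; $\exists(e,\varphi)$ and $\forall(e,\varphi)$ with $e$ an expression of type $(m,i)$ and $\varphi$ a formula of type $i$; and $\neg\varphi$, $\varphi\wedge\psi$, $\varphi\vee\psi$ with $\varphi,\psi$ of type $m$. A formula is conjunctive if it is $\mathit{true}$ or of the form $\varphi\wedge\psi$ or $\forall(e,\varphi)$, and disjunctive otherwise. A formula system $F$ over $X$ assigns to each $x\in X$ a formula $F(x)$ of type $\mathrm{rank}(x)$. A formula configuration is a triple $(\varphi,G,s)$ with $\varphi$ of type $m$, $G\in\mathbb G^m$ and $s\in\{\mathrm{pos},\mathrm{neg}\}$; it is universal if $s=\mathrm{pos}$ and $\varphi$ is conjunctive or $s=\mathrm{neg}$ and $\varphi$ is disjunctive, and existential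 otherwise. The steps are: from $(\neg\varphi,G,s)$ to $(\varphi,G,\bar s)$, where $\bar s$ is the opposite sign; from $(\varphi\wedge\psi,G,s)$ and from $(\varphi\vee\psi,G,s)$ to both $(\varphi,G,s)$ and $(\psi,G,s)$; from $(\exists(e,\varphi),G,s)$ and from $(\forall(e,\varphi),G,s)$ to $(\varphi,G\oslash P,s)$ for every frontal subgraph $P\in L(e)$ of $G$; and from $(x,G,s)$ to $(F(x),G,s)$. For $G_0\in\mathbb G^{\mathrm{rank}(x)}$ let $K$ be the graph of all formula configurations reachable from $(x,G_0,\mathrm{pos})$. The lower language $\underline L_x(F)$ is the set of $G_0\in\mathbb G^{\mathrm{rank}(x)}$ with $\alpha_K^*(x,G_0,\mathrm{pos})=\mathit{true}$, and the upper language $\overline L_x(F)$ is the set of those for which this value is not $\mathit{false}$. Theorem. Formula systems and alternating graph automata have equal expressive power: 1. For every alternating graph automaton $\mathcal A$ over $\Sigma$ with initial state $q_0$ there are a ranked set $X$, a formula system $F$ over $\Sigma$ and $X$, and a variable $x\in X$ with $\mathrm{rank}(x)=\mathrm{rank}(q_0)$ such that $\underline L_x(F)=\underline L(\mathcal A)$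 and $\overline L_x(F)=\overline L(\mathcal A)$. 2. For every ranked set $X$, every formula system $F$ over $\Sigma$ and $X$, and every $x\in X$ there is an alternating graph automaton $\mathcal A$ over $\Sigma$, with initial state $q_0$ of rank $\mathrm{rank}(x)$, such that $\underline L(\mathcal A)=\underline L_x(F)$ and $\overline L(\mathcal A)=\overline L_x(F)$. -/

import Mathlib

universe u v w z

namespace GraphForm

/-- A ranked set: a finite set together with a rank function. -/
structure RankedSet where
  carrier : Type u
  finite : Finite carrier
  rank : carrier → ℕ

instance : CoeSort RankedSet.{u} (Type u) := ⟨RankedSet.carrier⟩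

/-- A finite edge-labelled hypergraph over the ranked alphabet `Voc` with a front and a rear
interface.  Node names are taken from `ν` and edge names from `ε`.  The edges, their labels and
their attachments are given together by a partial function with finite domain: `inc e = none`
means that `e` is not an edge, and `inc e = some (a, s)` means that `e` is an edge with label `a`
attached to the node sequence `s`. -/
@[ext]
structure Graph (Voc : RankedSet.{u}) (ν : Type v) (ε : Type w) where
  nodes : Set ν
  inc : ε → Option (Voc × List ν)
  front : List ν
  rear : List ν
  nodes_finite : nodes.Finite
  edges_finite : {e | inc e ≠ none}.Finite
  inc_mem : ∀ e a s, inc e = some (a, s) → ∀ x ∈ s, x ∈ nodes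
  inc_rank : ∀ e a s, inc e = some (a, s) → s.length = Voc.rank a
  front_mem : ∀ x ∈ front, x ∈ nodes
  rear_mem : ∀ x ∈ rear, x ∈ nodes
  front_nodup : front.Nodup
  rear_nodup : rear.Nodup

namespace Graph

variable {Voc : RankedSet.{u}} {ν : Type v} {ε : Type w}

/-- The set of edges. -/
def edges (G : Graph Voc ν ε) : Set ε := {e | G.inc e ≠ none}

/-- `G` is of type `(m, n)`. -/
def HasType (G : Graph Voc ν ε) (m n : ℕ) : Prop :=
  G.front.length = m ∧ G.rear.length = n

/-- `G` is an identity graph on `n` nodes. -/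
def IsIdentity (n : ℕ) (G : Graph Voc ν ε) : Prop :=
  G.edges = ∅ ∧ G.nodes = {x | x ∈ G.front} ∧ G.front = G.rear ∧ G.front.length = n

/-- `G` and `H` are isomorphic: there are bijections between the nodes and between the edges
that preserve labels, attachments and both interfaces. -/
def Isomorphic (G H : Graph Voc ν ε) : Prop :=
  ∃ (f : ν → ν) (g : ε → ε),
    Set.BijOn f G.nodes H.nodes ∧ Set.BijOn g G.edges H.edges ∧
    (∀ e a s, G.inc e = some (a, s) → H.inc (g e) = some (a, s.map f)) ∧
    H.front = G.front.map f ∧ H.rear = G.rear.map f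

/-- `C` is the concatenation `G · H` of the concrete graphs `G` and `H`, which share exactly the
rear nodes of `G` (the front nodes of `H`) and no edges. -/
structure IsConcat (G H C : Graph Voc ν ε) : Prop where
  interface_eq : G.rear = H.front
  nodes_inter : G.nodes ∩ H.nodes = {x | x ∈ G.rear}
  edges_disjoint : Disjoint G.edges H.edges
  nodes_eq : C.nodes = G.nodes ∪ H.nodes
  inc_eq : ∀ e, C.inc e = (G.inc e).or (H.inc e)
  front_eq : C.front = G.front
  rear_eq : C.rear = H.rear

/-- `P` is a frontal subgraph of `H`. -/
structure IsFrontal (P H : Graph Voc ν ε) : Prop where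
  nodes_subset : P.nodes ⊆ H.nodes
  inc_eq : ∀ e ∈ P.edges, H.inc e = P.inc e
  front_eq : P.front = H.front
  rear_mem : ∀ x ∈ P.nodes, x ∈ H.rear → x ∈ P.rear

/-- The nodes that disappear when `P` is cut off: those of `P` outside the rear of `P`. -/
def inner (P : Graph Voc ν ε) : Set ν := {x | x ∈ P.nodes ∧ x ∉ P.rear}

/-- Edge `e` of `H` is attached to a node in `S`. -/
def Touches (H : Graph Voc ν ε) (e : ε) (S : Set ν) : Prop :=
  ∃ a s, H.inc e = some (a, s) ∧ ∃ x ∈ s, x ∈ S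

open Classical in
/-- Cutting the frontal subgraph `P` off `H`. -/
noncomputable def cut (H P : Graph Voc ν ε) (h : P.IsFrontal H) : Graph Voc ν ε where
  nodes := H.nodes \ P.inner
  inc := fun e => if e ∈ P.edges ∨ H.Touches e P.inner then none else H.inc e
  front := P.rear
  rear := H.rear
  nodes_finite := H.nodes_finite.subset Set.sdiff_subset
  edges_finite := H.edges_finite.subset (by
    intro e he
    simp only [Set.mem_ofPred_eq] at he ⊢
    split_ifs at he
    · exact absurd rfl he
    · exact he)
  inc_mem := by
    intro e a s he x hx
    split_ifs at he with hc
    refine ⟨H.inc_mem e a s he x hx, fun hin => hc (Or.inr ⟨a, s, he, x, hx, hin⟩)⟩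
  inc_rank := by
    intro e a s he
    split_ifs at he with hc
    exact H.inc_rank e a s he
  front_mem := fun x hx => ⟨h.nodes_subset (P.rear_mem x hx), fun hin => hin.2 hx⟩
  rear_mem := fun x hx => ⟨H.rear_mem x hx, fun hin => hin.2 (h.rear_mem x hin.1 hx)⟩
  front_nodup := P.rear_nodup
  rear_nodup := H.rear_nodup

end Graph

/-! ### Evaluation graphs -/

/-- An evaluation graph; the nodes that are not universal are existential. -/
structure EvalGraph where
  Node : Type z
  Edge : Node → Node → Prop
  Universal : Node → Prop

namespace EvalGraph

/-- Partial assignments of truth values to the nodes (`none` stands for undefined). -/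
abbrev Assignment (E : EvalGraph.{z}) : Type z := E.Node → Option Bool

open Classical in
/-- The assignment into which `α` evolves. -/
noncomputable def evo (E : EvalGraph.{z}) (α : E.Assignment) : E.Assignment := fun c =>
  if E.Universal c then
    if ∀ d, E.Edge c d → α d = some true then some true
    else if ∃ d, E.Edge c d ∧ α d = some false then some false
    else α c
  else
    if ∀ d, E.Edge c d → α d = some false then some false
    else if ∃ d, E.Edge c d ∧ α d = some true then some true
    else α c

/-- The completely undefined assignment. -/
def undef (E : EvalGraph.{z}) : E.Assignment := fun _ => none

/-- `α ⊑ β`: the assignment `β` agrees with `α` wherever `α` is defined. -/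
def Extends (E : EvalGraph.{z}) (α β : E.Assignment) : Prop :=
  ∀ c b, α c = some b → β c = some b

open Classical in
/-- The result of iterating `evo` from the completely undefined assignment: a node receives the
truth value that it gets after some number of iterations, and is undefined if it never gets one.
By `final_eq_iterate` and `final_isLeast` below this is, on finite evaluation graphs, the assignment
at which the iteration becomes stationary, and the smallest fixed point of `evo`. -/
noncomputable def final (E : EvalGraph.{z}) : E.Assignment := fun c =>
  if ∃ i, (E.evo^[i] E.undef) c = some true then some true
  else if ∃ i, (E.evo^[i] E.undef) c = some false then some false
  else none

/-- One of the four evolution rules gives the node `c` the value `b` under `α`. -/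
def Forced (E : EvalGraph.{z}) (α : E.Assignment) (c : E.Node) (b : Bool) : Prop :=
  (E.Universal c ∧ b = true ∧ ∀ d, E.Edge c d → α d = some true) ∨
  (E.Universal c ∧ b = false ∧ ∃ d, E.Edge c d ∧ α d = some false) ∨
  (¬ E.Universal c ∧ b = false ∧ ∀ d, E.Edge c d → α d = some false) ∨
  (¬ E.Universal c ∧ b = true ∧ ∃ d, E.Edge c d ∧ α d = some true)

theorem evo_of_forced (E : EvalGraph.{z}) {α : E.Assignment} {c : E.Node} {b : Bool}
    (h : E.Forced α c b) : E.evo α c = some b := by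
  rcases h with ⟨hu, rfl, h⟩ | ⟨hu, rfl, h⟩ | ⟨hu, rfl, h⟩ | ⟨hu, rfl, h⟩
  · simp only [evo, if_pos hu, if_pos h]
  · have h' : ¬ ∀ d, E.Edge c d → α d = some true := by
      intro h1; obtain ⟨d, hd, h2⟩ := h; have h3 := h1 d hd; rw [h2] at h3; simp at h3
    simp only [evo, if_pos hu, if_neg h', if_pos h]
  · simp only [evo, if_neg hu, if_pos h]
  · have h' : ¬ ∀ d, E.Edge c d → α d = some false := by
      intro h1; obtain ⟨d, hd, h2⟩ := h; have h3 := h1 d hd; rw [h2] at h3; simp at h3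
    simp only [evo, if_neg hu, if_neg h', if_pos h]

theorem forced_or_of_evo (E : EvalGraph.{z}) {α : E.Assignment} {c : E.Node} {b : Bool}
    (h : E.evo α c = some b) : E.Forced α c b ∨ α c = some b := by
  unfold evo at h
  unfold Forced
  split_ifs at h with h1 h2 h3 h4 h5 <;> simp_all

theorem Forced.mono {E : EvalGraph.{z}} {α β : E.Assignment} (hab : E.Extends α β) {c : E.Node}
    {b : Bool} (h : E.Forced α c b) : E.Forced β c b := by
  rcases h with ⟨hu, hb, h⟩ | ⟨hu, hb, d, hd, h⟩ | ⟨hu, hb, h⟩ | ⟨hu, hb, d, hd, h⟩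
  · exact Or.inl ⟨hu, hb, fun d hd => hab d _ (h d hd)⟩
  · exact Or.inr (Or.inl ⟨hu, hb, d, hd, hab d _ h⟩)
  · exact Or.inr (Or.inr (Or.inl ⟨hu, hb, fun d hd => hab d _ (h d hd)⟩))
  · exact Or.inr (Or.inr (Or.inr ⟨hu, hb, d, hd, hab d _ h⟩))

theorem forced_of_iterate (E : EvalGraph.{z}) (i : ℕ) :
    ∀ c b, (E.evo^[i] E.undef) c = some b → E.Forced (E.evo^[i] E.undef) c b := by
  induction i with
  | zero => intro c b h; simp [undef] at h
  | succ i ih =>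
    intro c b h
    rw [Function.iterate_succ_apply'] at h ⊢
    refine Forced.mono (fun d b' hd => E.evo_of_forced (ih d b' hd)) ?_
    exact (E.forced_or_of_evo h).elim id (ih c b)

theorem iterate_extends (E : EvalGraph.{z}) {i j : ℕ} (hij : i ≤ j) :
    E.Extends (E.evo^[i] E.undef) (E.evo^[j] E.undef) := by
  induction j, hij using Nat.le_induction with
  | base => exact fun _ _ h => h
  | succ j _ ih =>
    intro c b h
    rw [Function.iterate_succ_apply']
    exact E.evo_of_forced (E.forced_of_iterate j c b (ih c b h))

theorem final_eq_some_iff (E : EvalGraph.{z}) (c : E.Node) (b : Bool) :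
    E.final c = some b ↔ ∃ i, (E.evo^[i] E.undef) c = some b := by
  have key : ¬ ((∃ i, (E.evo^[i] E.undef) c = some true) ∧
      ∃ i, (E.evo^[i] E.undef) c = some false) := by
    rintro ⟨⟨i, hi⟩, j, hj⟩
    have h1 := E.iterate_extends (le_max_left i j) c _ hi
    have h2 := E.iterate_extends (le_max_right i j) c _ hj
    rw [h1] at h2; simp at h2
  unfold final
  cases b <;> split_ifs with h1 h2 <;> simp_all

/-- On a finite evaluation graph the iteration becomes stationary at `final`. -/
theorem final_eq_iterate (E : EvalGraph.{z}) [Finite E.Node] :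
    ∃ i, ∀ j, i ≤ j → E.evo^[j] E.undef = E.final := by
  classical
  have h0 : ∀ c, ∃ i, ∀ b, E.final c = some b → (E.evo^[i] E.undef) c = some b := by
    intro c
    cases hc : E.final c with
    | none => exact ⟨0, by simp⟩
    | some b =>
      obtain ⟨i, hi⟩ := (E.final_eq_some_iff c b).1 hc
      exact ⟨i, fun b' hb' => by rw [hi, hb']⟩
  choose f hf using h0
  obtain ⟨n, hn⟩ := (Set.finite_range f).bddAbove
  refine ⟨n, fun j hj => funext fun c => Option.ext fun b => ⟨fun h => ?_, fun h => ?_⟩⟩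
  · exact (E.final_eq_some_iff c b).2 ⟨j, h⟩
  · exact E.iterate_extends ((hn ⟨c, rfl⟩).trans hj) c b (hf c b h)

/-- On a finite evaluation graph `final` is the smallest fixed point of `evo`. -/
theorem final_isLeast (E : EvalGraph.{z}) [Finite E.Node] :
    E.evo E.final = E.final ∧ ∀ β, E.evo β = β → E.Extends E.final β := by
  constructor
  · obtain ⟨i, hi⟩ := E.final_eq_iterate
    have h1 := hi (i + 1) (Nat.le_succ i)
    rwa [Function.iterate_succ_apply', hi i le_rfl] at h1
  · intro β hβ c b hc
    obtain ⟨i, hi⟩ := (E.final_eq_some_iff c b).1 hc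
    have h2 : ∀ i, E.Extends (E.evo^[i] E.undef) β := by
      intro i
      induction i with
      | zero => intro c b h; simp [undef] at h
      | succ i ih =>
        intro c b h
        rw [Function.iterate_succ_apply'] at h
        have h3 := (E.forced_or_of_evo h).elim id (E.forced_of_iterate i c b)
        rw [← hβ]
        exact E.evo_of_forced (h3.mono ih)
    exact h2 i c b hi

end EvalGraph

/-! ### Alternating graph automata -/

/-- An alternating graph automaton; the states outside `universal` are existential. -/
structure GraphAutomaton (Voc : RankedSet.{u}) (ν : Type v) (ε : Type w) where
  Q : RankedSet.{z}
  Δ : Set (Q × Graph Voc ν ε × Q)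
  finite : Δ.Finite
  typed : ∀ q Γ r, (q, Γ, r) ∈ Δ → Γ.HasType (Q.rank q) (Q.rank r)
  start : Q
  universal : Set Q

namespace GraphAutomaton

variable {Voc : RankedSet.{u}} {ν : Type v} {ε : Type w}

/-- A configuration: a state and a graph whose front interface has the rank of the state. -/
structure Config (A : GraphAutomaton.{u, v, w, z} Voc ν ε) where
  state : A.Q
  graph : Graph Voc ν ε
  typed : graph.front.length = A.Q.rank state

/-- A transition step between configurations. -/
def Step (A : GraphAutomaton.{u, v, w, z} Voc ν ε) (c d : A.Config) : Prop :=
  ∃ Γ P, (c.state, Γ, d.state) ∈ A.Δ ∧ Γ.Isomorphic P ∧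
    ∃ h : P.IsFrontal c.graph, d.graph = c.graph.cut P h

/-- The configuration graph with initial configuration `c₀`. -/
def configGraph (A : GraphAutomaton.{u, v, w, z} Voc ν ε) (c₀ : A.Config) : EvalGraph where
  Node := {c : A.Config // Relation.ReflTransGen A.Step c₀ c}
  Edge := fun c d => A.Step c.1 d.1
  Universal := fun c => c.1.state ∈ A.universal

/-- The truth value (if any) that the initial configuration for the input graph `G` receives. -/
noncomputable def value (A : GraphAutomaton.{u, v, w, z} Voc ν ε) (G : Graph Voc ν ε)
    (h : G.front.length = A.Q.rank A.start) : Option Bool :=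
  (A.configGraph ⟨A.start, G, h⟩).final ⟨⟨A.start, G, h⟩, Relation.ReflTransGen.refl⟩

/-- The lower language: the input graphs that are accepted. -/
def lowerLanguage (A : GraphAutomaton.{u, v, w, z} Voc ν ε) : Set (Graph Voc ν ε) :=
  {G | ∃ h, A.value G h = some true}

/-- The upper language: the input graphs that are not rejected. -/
def upperLanguage (A : GraphAutomaton.{u, v, w, z} Voc ν ε) : Set (Graph Voc ν ε) :=
  {G | ∃ h, A.value G h ≠ some false}

end GraphAutomaton

/-! ### Graph expressions -/

/-- Concatenation of graph languages. -/
def langConcat {Voc : RankedSet.{u}} {ν : Type v} {ε : Type w}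
    (L M : Set (Graph Voc ν ε)) : Set (Graph Voc ν ε) :=
  {C | ∃ G ∈ L, ∃ H ∈ M, G.IsConcat H C}

/-- Kleene star of a language of graphs of type `(i, i)`. -/
inductive LangStar {Voc : RankedSet.{u}} {ν : Type v} {ε : Type w}
    (i : ℕ) (L : Set (Graph Voc ν ε)) : Graph Voc ν ε → Prop
  | identity (G : Graph Voc ν ε) (h : G.IsIdentity i) : LangStar i L G
  | concat (G H C : Graph Voc ν ε) (hG : G ∈ L) (hH : LangStar i L H) (h : G.IsConcat H C) :
      LangStar i L C

/-- Graph expressions of type `(i, j)`. -/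
inductive GraphExpr (Voc : RankedSet.{u}) (ν : Type v) (ε : Type w) :
    ℕ → ℕ → Type (max u v w)
  | empty {i j : ℕ} : GraphExpr Voc ν ε i j
  | graph {i j : ℕ} (G : Graph Voc ν ε) (h : G.HasType i j) : GraphExpr Voc ν ε i j
  | union {i j : ℕ} (a b : GraphExpr Voc ν ε i j) : GraphExpr Voc ν ε i j
  | concat {i j k : ℕ} (a : GraphExpr Voc ν ε i j) (b : GraphExpr Voc ν ε j k) :
      GraphExpr Voc ν ε i k
  | star {i : ℕ} (a : GraphExpr Voc ν ε i i) : GraphExpr Voc ν ε i i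

/-- The graph language denoted by an expression.  Graphs in expressions are meant up to
isomorphism, so a single graph denotes the set of its isomorphic copies. -/
def GraphExpr.lang {Voc : RankedSet.{u}} {ν : Type v} {ε : Type w} :
    {i j : ℕ} → GraphExpr Voc ν ε i j → Set (Graph Voc ν ε)
  | _, _, .empty => ∅
  | _, _, .graph G _ => {P | G.Isomorphic P}
  | _, _, .union a b => a.lang ∪ b.lang
  | _, _, .concat a b => langConcat a.lang b.lang
  | i, _, .star a => {P | LangStar i a.lang P}

/-! ### Formula systems -/

/-- Graph formulas of type `m` with variables in `X`. -/
inductive Formula (Voc : RankedSet.{u}) (ν : Type v) (ε : Type w) (X : RankedSet.{z}) :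
    ℕ → Type (max u v w z)
  | tt {m : ℕ} : Formula Voc ν ε X m
  | ff {m : ℕ} : Formula Voc ν ε X m
  | var {m : ℕ} (x : X) (h : X.rank x = m) : Formula Voc ν ε X m
  | ex {m i : ℕ} (e : GraphExpr Voc ν ε m i) (fo : Formula Voc ν ε X i) : Formula Voc ν ε X m
  | all {m i : ℕ} (e : GraphExpr Voc ν ε m i) (fo : Formula Voc ν ε X i) : Formula Voc ν ε X m
  | neg {m : ℕ} (fo : Formula Voc ν ε X m) : Formula Voc ν ε X m
  | and {m : ℕ} (fo₁ fo₂ : Formula Voc ν ε X m) : Formula Voc ν ε X m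
  | or {m : ℕ} (fo₁ fo₂ : Formula Voc ν ε X m) : Formula Voc ν ε X m

/-- Conjunctive formulas; all others are disjunctive. -/
def Formula.Conjunctive {Voc : RankedSet.{u}} {ν : Type v} {ε : Type w} {X : RankedSet.{z}} :
    {m : ℕ} → Formula Voc ν ε X m → Prop
  | _, .tt => True
  | _, .and _ _ => True
  | _, .all _ _ => True
  | _, _ => False

/-- A formula system over the variables `X`. -/
def FormulaSystem (Voc : RankedSet.{u}) (ν : Type v) (ε : Type w) (X : RankedSet.{z}) :
    Type (max u v w z) :=
  ∀ x : X, Formula Voc ν ε X (X.rank x)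

inductive Sign
  | pos
  | neg

def Sign.flip : Sign → Sign
  | .pos => .neg
  | .neg => .pos

/-- A formula configuration. -/
structure FormulaConfig (Voc : RankedSet.{u}) (ν : Type v) (ε : Type w) (X : RankedSet.{z}) where
  arity : ℕ
  formula : Formula Voc ν ε X arity
  graph : Graph Voc ν ε
  sign : Sign
  typed : graph.front.length = arity

/-- Universal formula configurations; all others are existential. -/
def FormulaConfig.Universal {Voc : RankedSet.{u}} {ν : Type v} {ε : Type w} {X : RankedSet.{z}}
    (c : FormulaConfig Voc ν ε X) : Prop :=
  (c.sign = Sign.pos ∧ c.formula.Conjunctive) ∨ (c.sign = Sign.neg ∧ ¬ c.formula.Conjunctive)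

namespace FormulaSystem

variable {Voc : RankedSet.{u}} {ν : Type v} {ε : Type w} {X : RankedSet.{z}}

/-- Steps between formula configurations. -/
inductive Step (F : FormulaSystem Voc ν ε X) :
    FormulaConfig Voc ν ε X → FormulaConfig Voc ν ε X → Prop
  | neg {m : ℕ} (fo : Formula Voc ν ε X m) (G : Graph Voc ν ε) (s : Sign)
      (h : G.front.length = m) : Step F ⟨m, .neg fo, G, s, h⟩ ⟨m, fo, G, s.flip, h⟩
  | and_left {m : ℕ} (fo₁ fo₂ : Formula Voc ν ε X m) (G : Graph Voc ν ε) (s : Sign)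
      (h : G.front.length = m) : Step F ⟨m, .and fo₁ fo₂, G, s, h⟩ ⟨m, fo₁, G, s, h⟩
  | and_right {m : ℕ} (fo₁ fo₂ : Formula Voc ν ε X m) (G : Graph Voc ν ε) (s : Sign)
      (h : G.front.length = m) : Step F ⟨m, .and fo₁ fo₂, G, s, h⟩ ⟨m, fo₂, G, s, h⟩
  | or_left {m : ℕ} (fo₁ fo₂ : Formula Voc ν ε X m) (G : Graph Voc ν ε) (s : Sign)
      (h : G.front.length = m) : Step F ⟨m, .or fo₁ fo₂, G, s, h⟩ ⟨m, fo₁, G, s, h⟩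
  | or_right {m : ℕ} (fo₁ fo₂ : Formula Voc ν ε X m) (G : Graph Voc ν ε) (s : Sign)
      (h : G.front.length = m) : Step F ⟨m, .or fo₁ fo₂, G, s, h⟩ ⟨m, fo₂, G, s, h⟩
  | ex {m i : ℕ} (e : GraphExpr Voc ν ε m i) (fo : Formula Voc ν ε X i) (G : Graph Voc ν ε)
      (s : Sign) (h : G.front.length = m) (P : Graph Voc ν ε) (hP : P ∈ e.lang)
      (hf : P.IsFrontal G) (h' : (G.cut P hf).front.length = i) :
      Step F ⟨m, .ex e fo, G, s, h⟩ ⟨i, fo, G.cut P hf, s, h'⟩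
  | all {m i : ℕ} (e : GraphExpr Voc ν ε m i) (fo : Formula Voc ν ε X i) (G : Graph Voc ν ε)
      (s : Sign) (h : G.front.length = m) (P : Graph Voc ν ε) (hP : P ∈ e.lang)
      (hf : P.IsFrontal G) (h' : (G.cut P hf).front.length = i) :
      Step F ⟨m, .all e fo, G, s, h⟩ ⟨i, fo, G.cut P hf, s, h'⟩
  | var {m : ℕ} (x : X) (hx : X.rank x = m) (G : Graph Voc ν ε) (s : Sign)
      (h : G.front.length = m) (h' : G.front.length = X.rank x) :
      Step F ⟨m, .var x hx, G, s, h⟩ ⟨X.rank x, F x, G, s, h'⟩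

/-- The formula configuration graph with initial configuration `c₀`. -/
def configGraph (F : FormulaSystem Voc ν ε X) (c₀ : FormulaConfig Voc ν ε X) : EvalGraph where
  Node := {c : FormulaConfig Voc ν ε X // Relation.ReflTransGen F.Step c₀ c}
  Edge := fun c d => F.Step c.1 d.1
  Universal := fun c => c.1.Universal

/-- The initial formula configuration at the variable `x` for the input graph `G`. -/
def initialConfig (x : X) (G : Graph Voc ν ε) (h : G.front.length = X.rank x) :
    FormulaConfig Voc ν ε X :=
  ⟨X.rank x, .var x rfl, G, Sign.pos, h⟩

/-- The truth value (if any) that the initial configuration at `x` for `G` receives. -/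
noncomputable def value (F : FormulaSystem Voc ν ε X) (x : X) (G : Graph Voc ν ε)
    (h : G.front.length = X.rank x) : Option Bool :=
  (F.configGraph (initialConfig x G h)).final ⟨initialConfig x G h, Relation.ReflTransGen.refl⟩

/-- The lower language at `x`: the input graphs that are accepted. -/
def lowerLanguage (F : FormulaSystem Voc ν ε X) (x : X) : Set (Graph Voc ν ε) :=
  {G | ∃ h, F.value x G h = some true}

/-- The upper language at `x`: the input graphs that are not rejected. -/
def upperLanguage (F : FormulaSystem Voc ν ε X) (x : X) : Set (Graph Voc ν ε) :=
  {G | ∃ h, F.value x G h ≠ some false}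

end FormulaSystem

end GraphForm

open GraphForm

/-!
Both translations keep the input graph and replace a single step of one device by a finite
sequence of steps of the other, so both follow from one fact about evaluation graphs,
`EvalGraph.Refines.val_iff`: replacing edges by paths preserves truth values, including undefined
ones, if the nodes on the paths are of the same kind as the node the replaced edge starts from (or
have only one successor), and if no path runs through intermediate nodes forever.  Since all
configurations have finitely many successors, the iterated evolution agrees with well-founded
derivability (`EvalGraph.final_eq_some_iff_val`), for which this is proved by induction.

An automaton becomes a formula system with the states as variables: the formula of a state is
the conjunction or disjunction, over the transitions `(q, Γ, r)`, of `∀(Γ, r)` or `∃(Γ, r)`.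

Conversely, the states of the automaton for a formula system are the signed subformulas, where
steps that leave the graph unchanged cut off an identity graph.  For a quantifier `∃(e, φ)` or
`∀(e, φ)` the automaton cuts off a graph in `L(e)` piece by piece, keeping a stack of expressions;
this is possible because cutting off a concatenation amounts to cutting off its factors one after
the other (`Graph.cuts_langConcat`).  The difficulty is the Kleene star: an iterated graph may
remove nothing, for instance if it only permutes the interface, and an infinite sequence of such
steps would leave a configuration undefined although the formula has a value.  The states therefore
carry a counter that decreases with every step and is reset only when a node or an edge is removed,
which enforces termination.  No graph is lost, provided the counter is large enough
(`Stack.exists_counted`): while nothing is removed, the front only grows as a set, so each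
configuration on the way is determined by its stack and the positions of its front nodes in the
last front, which are finitely many data independent of the graph, and cycles can be left out.
-/

namespace GraphForm

/-! ### Evaluation by well-founded derivations, and refinement of evaluation graphs -/

namespace EvalGraph

/-- `E.Val c b`: the node `c` receives the value `b` by a well-founded derivation from the evolution
rules.  The rules for the two kinds of nodes are stated together: `all` derives `true` at universal
and `false` at existential nodes, `one` derives `false` at universal and `true` at existential
nodes. -/
inductive Val (E : EvalGraph.{z}) : E.Node → Bool → Prop
  | all (c : E.Node) (b : Bool) (hu : E.Universal c ↔ b = true)
      (h : ∀ d, E.Edge c d → Val E d b) : Val E c b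
  | one (c d : E.Node) (b : Bool) (hu : E.Universal c ↔ b = false) (he : E.Edge c d)
      (h : Val E d b) : Val E c b

theorem val_of_forced (E : EvalGraph.{z}) {α : E.Assignment}
    (hα : ∀ c b, α c = some b → E.Val c b) {c : E.Node} {b : Bool} (h : E.Forced α c b) :
    E.Val c b := by
  rcases h with ⟨hu, rfl, h⟩ | ⟨hu, rfl, d, hd, h⟩ | ⟨hu, rfl, h⟩ | ⟨hu, rfl, d, hd, h⟩
  · exact .all _ _ (by simp [hu]) fun d hd => hα _ _ (h d hd)
  · exact .one _ d _ (by simp [hu]) hd (hα _ _ h)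
  · exact .all _ _ (by simp [hu]) fun d hd => hα _ _ (h d hd)
  · exact .one _ d _ (by simp [hu]) hd (hα _ _ h)

/-- If every node has finitely many successors, `ω` rounds of evolution reach every node that has a
well-founded derivation. -/
theorem final_eq_some_iff_val (E : EvalGraph.{z}) (hfin : ∀ c, {d | E.Edge c d}.Finite)
    (c : E.Node) (b : Bool) : E.final c = some b ↔ E.Val c b := by
  rw [final_eq_some_iff]
  constructor
  · rintro ⟨i, hi⟩
    induction i generalizing c b with
    | zero => simp [undef] at hi
    | succ i ih =>
      rw [Function.iterate_succ_apply'] at hi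
      rcases E.forced_or_of_evo hi with h | h
      · exact E.val_of_forced ih h
      · exact ih c b h
  · intro h
    induction h with
    | all c b hu _ ih =>
      choose! f hf using ih
      obtain ⟨n, hn⟩ := ((hfin c).image f).bddAbove
      refine ⟨n + 1, ?_⟩
      rw [Function.iterate_succ_apply']
      have h1 : ∀ d, E.Edge c d → (E.evo^[n] E.undef) d = some b := fun d hd =>
        E.iterate_extends (hn ⟨d, hd, rfl⟩) d b (hf d hd)
      apply E.evo_of_forced
      cases b
      · exact Or.inr (Or.inr (Or.inl ⟨by simpa using hu, rfl, h1⟩))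
      · exact Or.inl ⟨by simpa using hu, rfl, h1⟩
    | one c d b hu he _ ih =>
      obtain ⟨i, hi⟩ := ih
      refine ⟨i + 1, ?_⟩
      rw [Function.iterate_succ_apply']
      apply E.evo_of_forced
      cases b
      · exact Or.inr (Or.inl ⟨by simpa using hu, rfl, d, he, hi⟩)
      · exact Or.inr (Or.inr (Or.inr ⟨by simpa using hu, rfl, d, he, hi⟩))

/-- The node `d` has exactly one successor; its kind is then irrelevant for its value. -/
def Single (E : EvalGraph.{z}) (d : E.Node) : Prop := ∃ e, ∀ e', E.Edge d e' ↔ e' = e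

theorem val_of_forall (E : EvalGraph.{z}) {d : E.Node} {b : Bool}
    (hu : (E.Universal d ↔ b = true) ∨ E.Single d) (h : ∀ e, E.Edge d e → E.Val e b) :
    E.Val d b := by
  by_cases hu' : E.Universal d ↔ b = true
  · exact .all _ _ hu' h
  · obtain ⟨e, he⟩ := hu.resolve_left hu'
    have h1 := (he e).2 rfl
    exact .one _ e _ (by cases b <;> simp_all) h1 (h e h1)

theorem val_of_exists (E : EvalGraph.{z}) {d e : E.Node} {b : Bool}
    (hu : (E.Universal d ↔ b = false) ∨ E.Single d) (hde : E.Edge d e) (h : E.Val e b) :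
    E.Val d b := by
  by_cases hu' : E.Universal d ↔ b = false
  · exact .one _ e _ hu' hde h
  · obtain ⟨e₀, he⟩ := hu.resolve_left hu'
    obtain rfl := (he e).1 hde
    refine .all _ _ (by cases b <;> simp_all) fun e' he' => ?_
    rwa [(he e').1 he']

/-- `E.Reach I n n'`: there is a nonempty path from `n` to `n'` whose inner nodes satisfy `I`. -/
inductive Reach (E : EvalGraph.{z}) (I : E.Node → Prop) : E.Node → E.Node → Prop
  | edge {n n'} (h : E.Edge n n') : Reach E I n n'
  | step {n d n'} (h : E.Edge n d) (hd : I d) (h' : Reach E I d n') : Reach E I n n'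

/-- The evaluation graph `E'` refines the evaluation graph `E`: a node `c` of `E` is represented by
the nodes `n` with `M c n`, and an edge of `E` leaving `c` is replaced by the paths through
intermediate nodes `d` with `I c d`.  Intermediate nodes are of the same kind as `c` unless they
have a unique successor, and no path through intermediate nodes is infinite. -/
structure Refines (E : EvalGraph.{w}) (E' : EvalGraph.{z}) (M I : E.Node → E'.Node → Prop) :
    Prop where
  kind : ∀ c d, M c d ∨ I c d → (E'.Universal d ↔ E.Universal c) ∨ E'.Single d
  sound : ∀ c d d', M c d ∨ I c d → E'.Edge d d' → I c d' ∨ ∃ c', E.Edge c c' ∧ M c' d'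
  complete : ∀ c c' n, M c n → E.Edge c c' → ∃ n', M c' n' ∧ E'.Reach (I c) n n'
  wf : WellFounded fun d' d => E'.Edge d d' ∧ ∃ c, I c d ∧ I c d'

namespace Refines

variable {E : EvalGraph.{w}} {E' : EvalGraph.{z}} {M I : E.Node → E'.Node → Prop}

/-- Values carry over to the refinement: a `one` step is copied along the path that replaces the
edge, and for an `all` step termination allows an induction over the intermediate nodes. -/
theorem val_of_val (H : Refines E E' M I) {c : E.Node} {b : Bool} (h : E.Val c b) :
    ∀ n, M c n → E'.Val n b := by
  induction h with
  | all c b hu _ ih =>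
    have key : ∀ d, M c d ∨ I c d → (∀ d', E'.Edge d d' → I c d' → E'.Val d' b) →
        E'.Val d b := by
      intro d hd hI
      refine E'.val_of_forall ((H.kind c d hd).imp_left fun h => h.trans hu) fun d' hd' => ?_
      rcases H.sound c d d' hd hd' with h | ⟨c', hc, hm⟩
      · exact hI d' hd' h
      · exact ih c' hc d' hm
    have hint : ∀ d, I c d → E'.Val d b := by
      intro d
      induction d using H.wf.induction with
      | _ d ihd => exact fun hd => key d (Or.inr hd) fun d' he hd' => ihd d' ⟨he, c, hd, hd'⟩ hd'
    exact fun n hn => key n (Or.inl hn) fun d' _ hd' => hint d' hd'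
  | one c c' b hu he _ ih =>
    intro n hn
    obtain ⟨n', hn', hr⟩ := H.complete c c' n hn he
    have hv := ih n' hn'
    have hn0 : M c n ∨ I c n := Or.inl hn
    clear hn
    induction hr with
    | @edge n n' h =>
      exact E'.val_of_exists ((H.kind c _ hn0).imp_left fun h => h.trans hu) h hv
    | @step n d n' h hd _ ih' =>
      exact E'.val_of_exists ((H.kind c _ hn0).imp_left fun h => h.trans hu) h
        (ih' hn' hv (Or.inr hd))

/-- What the value `b` of a node `d` of the refinement, which represents `c` or is intermediate for
it, says about the successors of `c`: some of them has the value `b`, or all those that are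
represented by nodes reachable from `d`, depending on the kind of `c`. -/
def Partial (M I : E.Node → E'.Node → Prop) (d : E'.Node) (b : Bool) : Prop :=
  ∀ c, M c d ∨ I c d →
    ((E.Universal c ↔ b = false) → ∃ c', E.Edge c c' ∧ E.Val c' b) ∧
    ((E.Universal c ↔ b = true) → ∀ n', E'.Reach (I c) d n' → ∀ c', M c' n' → E.Val c' b)

theorem val_of_partial (H : Refines E E' M I) {n : E'.Node} {b : Bool} (h : Partial M I n b)
    {c : E.Node} (hc : M c n) : E.Val c b := by
  obtain ⟨h1, h2⟩ := h c (Or.inl hc)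
  by_cases hu : E.Universal c ↔ b = true
  · refine .all _ _ hu fun c' hc' => ?_
    obtain ⟨n', hn', hr⟩ := H.complete c c' n hc hc'
    exact h2 hu n' hr c' hn'
  · have hu' : E.Universal c ↔ b = false := by cases b <;> simp_all
    obtain ⟨c', hc', hv⟩ := h1 hu'
    exact .one _ c' _ hu' hc' hv

/-- The induction behind the converse direction.  If the rule that gave `d` its value does not have
the form that the kind of `c` calls for, then `d` has a unique successor, for which both forms of
the rules say the same. -/
theorem partial_of_val (H : Refines E E' M I) {d : E'.Node} {b : Bool} (h : E'.Val d b) :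
    Partial M I d b := by
  have witness : ∀ c d d', (M c d ∨ I c d) → E'.Edge d d' → Partial M I d' b →
      (E.Universal c ↔ b = false) → ∃ c', E.Edge c c' ∧ E.Val c' b := by
    intro c d d' hd he hp hu
    rcases H.sound c d d' hd he with h | ⟨c', hc, hm⟩
    · exact (hp c (Or.inr h)).1 hu
    · exact ⟨c', hc, H.val_of_partial hp hm⟩
  have every : ∀ c d, (∀ d', E'.Edge d d' → Partial M I d' b) →
      (E.Universal c ↔ b = true) → ∀ n', E'.Reach (I c) d n' → ∀ c', M c' n' → E.Val c' b := by
    intro c d hp hu n' hr c' hc'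
    cases hr with
    | edge h => exact H.val_of_partial (hp _ h) hc'
    | step h hd h' => exact (hp _ h c (Or.inr hd)).2 hu n' h' c' hc'
  induction h with
  | all d b hu _ ih =>
    refine fun c hc => ⟨fun hu' => ?_, every c d (fun d' he => ih d' he witness every)⟩
    have hs : E'.Single d := (H.kind c d hc).resolve_left fun h => by
      have := h.symm.trans hu
      cases b <;> simp_all
    obtain ⟨e, he⟩ := hs
    have h1 := (he e).2 rfl
    exact witness c d e hc h1 (ih e h1 witness every) hu'
  | one d d₁ b hu he _ ih =>
    refine fun c hc => ⟨witness c d d₁ hc he (ih witness every), fun hu' => ?_⟩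
    have hs : E'.Single d := (H.kind c d hc).resolve_left fun h => by
      have := h.symm.trans hu
      cases b <;> simp_all
    obtain ⟨e, hd⟩ := hs
    refine every c d (fun d' hd' => ?_) hu'
    rw [(hd d').1 hd', ← (hd d₁).1 he]
    exact ih witness every

/-- Refinement preserves values. -/
theorem val_iff (H : Refines E E' M I) {c : E.Node} {n : E'.Node} (h : M c n) (b : Bool) :
    E.Val c b ↔ E'.Val n b :=
  ⟨fun hv => H.val_of_val hv n h, fun hv => H.val_of_partial (H.partial_of_val hv) h⟩

end Refines

/-- The part of an evaluation graph that is reachable from a node determines the values there. -/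
theorem val_reachable_iff (E : EvalGraph.{z}) (P : E.Node → Prop)
    (hP : ∀ c d, P c → E.Edge c d → P d) (c : {c // P c}) (b : Bool) :
    Val ⟨{c // P c}, fun c d => E.Edge c.1 d.1, fun c => E.Universal c.1⟩ c b ↔ E.Val c.1 b := by
  refine Refines.val_iff (M := fun (c : {c // P c}) n => c.1 = n) (I := fun _ _ => False)
    ⟨?_, ?_, ?_, ?_⟩ rfl b
  · rintro c _ (rfl | ⟨⟨⟩⟩)
    exact Or.inl Iff.rfl
  · rintro c _ d (rfl | ⟨⟨⟩⟩) hd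
    exact Or.inr ⟨⟨d, hP _ _ c.2 hd⟩, hd, rfl⟩
  · rintro c c' _ rfl he
    exact ⟨_, rfl, .edge he⟩
  · exact ⟨fun d => ⟨d, fun d' h => by simp at h⟩⟩

end EvalGraph

/-! ### Cutting off frontal subgraphs -/

namespace Graph

variable {Voc : RankedSet.{u}} {ν : Type v} {ε : Type w}

/-- `T'` results from `T` by cutting off a frontal subgraph that belongs to `L`. -/
def Cuts (L : Set (Graph Voc ν ε)) (T T' : Graph Voc ν ε) : Prop :=
  ∃ P ∈ L, ∃ h : P.IsFrontal T, T' = T.cut P h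

theorem Cuts.mono {L M : Set (Graph Voc ν ε)} (hLM : L ⊆ M) {T T' : Graph Voc ν ε}
    (h : Cuts L T T') : Cuts M T T' := by
  obtain ⟨P, hP, h⟩ := h
  exact ⟨P, hLM hP, h⟩

theorem cut_inc_eq_some {T P : Graph Voc ν ε} (h : P.IsFrontal T) {e : ε} {a : Voc × List ν} :
    (T.cut P h).inc e = some a ↔
      T.inc e = some a ∧ e ∉ P.edges ∧ ∀ x ∈ a.2, x ∉ P.inner := by
  classical
  simp only [cut]
  split_ifs with hc
  · simp only [false_iff]
    rintro ⟨h1, h2, h3⟩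
    rcases hc with hc | ⟨b, s, hb, x, hx, hi⟩
    · exact h2 hc
    · rw [h1] at hb
      cases hb
      exact h3 x hx hi
  · refine ⟨fun h1 => ⟨h1, fun h2 => hc (Or.inl h2), fun x hx hi => ?_⟩, fun h => h.1⟩
    exact hc (Or.inr ⟨a.1, a.2, h1, x, hx, hi⟩)

/-- The frontal subgraphs of a graph form a finite set. -/
theorem finite_setOf_isFrontal (T : Graph Voc ν ε) : {P | IsFrontal P T}.Finite := by
  classical
  have h1 : (T.nodes.powerset).Finite := T.nodes_finite.powerset
  have h2 : (T.edges.powerset).Finite := Set.Finite.powerset T.edges_finite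
  have h3 : {l : List ν | l.Nodup ∧ ∀ x ∈ l, x ∈ T.nodes}.Finite := by
    have := T.nodes_finite.to_subtype
    have h4 : {l : List T.nodes | l.length ≤ T.nodes.ncard}.Finite := List.finite_length_le _ _
    refine (h4.image (List.map Subtype.val)).subset ?_
    rintro l ⟨hl, hm⟩
    refine ⟨l.attach.map fun x => ⟨x.1, hm _ x.2⟩, ?_, ?_⟩
    · have : l.toFinset.card ≤ T.nodes.ncard := by
        rw [← Set.ncard_coe_finset]
        exact Set.ncard_le_ncard (by intro x hx; exact hm x (by simpa using hx)) T.nodes_finite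
      rw [List.toFinset_card_of_nodup hl] at this
      simpa using this
    · simp
  refine ((h1.prod (h2.prod h3)).subset ?_).of_injOn (f := fun P => (P.nodes, P.edges, P.rear))
    (s := {P | IsFrontal P T}) (t := {p | p.1 ∈ T.nodes.powerset ∧
      p.2.1 ∈ T.edges.powerset ∧ p.2.2.Nodup ∧ ∀ x ∈ p.2.2, x ∈ T.nodes}) ?_ ?_
  · rintro ⟨a, b, c⟩ ⟨h, h', h''⟩
    exact ⟨h, h', h''⟩
  · rintro P (hP : IsFrontal P T)
    refine ⟨hP.nodes_subset, fun e he => ?_, P.rear_nodup, fun x hx =>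
      hP.nodes_subset (P.rear_mem x hx)⟩
    change T.inc e ≠ none
    rw [hP.inc_eq e he]
    exact he
  · rintro P (hP : IsFrontal P T) P' (hP' : IsFrontal P' T) h
    simp only [Prod.mk.injEq] at h
    obtain ⟨hn, he, hr⟩ := h
    refine Graph.ext hn (funext fun e => ?_) (hP.front_eq.trans hP'.front_eq.symm) hr
    by_cases h : e ∈ P.edges
    · rw [← hP.inc_eq e h, ← hP'.inc_eq e (he ▸ h)]
    · have h' : e ∉ P'.edges := he ▸ h
      simp only [edges, Set.mem_ofPred_eq, not_not] at h h'
      rw [h, h']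

theorem finite_setOf_cuts (L : Set (Graph Voc ν ε)) (T : Graph Voc ν ε) :
    {T' | Cuts L T T'}.Finite := by
  classical
  have := (finite_setOf_isFrontal T).image fun P => if h : IsFrontal P T then T.cut P h else T
  refine this.subset ?_
  rintro _ ⟨P, -, h, rfl⟩
  exact ⟨P, h, by simp [h]⟩

theorem Cuts.front_length {L : Set (Graph Voc ν ε)} {m n : ℕ} (hL : ∀ P ∈ L, HasType P m n)
    {T T' : Graph Voc ν ε} (h : Cuts L T T') : T.front.length = m ∧ T'.front.length = n := by
  obtain ⟨P, hP, h, rfl⟩ := h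
  exact ⟨h.front_eq ▸ (hL P hP).1, (hL P hP).2⟩

/-! ### Cutting off concatenations, iterations and identity graphs -/

namespace IsConcat

variable {G H C T : Graph Voc ν ε}

theorem edges_eq (h : G.IsConcat H C) : C.edges = G.edges ∪ H.edges := by
  ext e
  simp only [edges, Set.mem_ofPred_eq, Set.mem_union, h.inc_eq]
  cases G.inc e <;> simp

theorem inner_eq (h : G.IsConcat H C) : C.inner = G.inner ∪ H.inner := by
  ext x
  have h1 : x ∈ G.nodes ∩ H.nodes ↔ x ∈ G.rear := by rw [h.nodes_inter]; rfl
  have h2 := H.rear_mem x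
  simp only [inner, Set.mem_ofPred_eq, Set.mem_union, h.nodes_eq, h.rear_eq, Set.mem_inter_iff]
    at h1 ⊢
  tauto

theorem inc_of_left (h : G.IsConcat H C) {e : ε} (he : e ∈ G.edges) : C.inc e = G.inc e := by
  rw [h.inc_eq]
  obtain ⟨a, ha⟩ := Option.ne_none_iff_exists'.1 he
  simp [ha]

theorem inc_of_right (h : G.IsConcat H C) {e : ε} (he : e ∈ H.edges) : C.inc e = H.inc e := by
  rw [h.inc_eq]
  have : e ∉ G.edges := fun h' => Set.disjoint_left.1 h.edges_disjoint h' he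
  simp only [edges, Set.mem_ofPred_eq, not_not] at this
  simp [this]

theorem isFrontal_left (h : G.IsConcat H C) (hC : C.IsFrontal T) : G.IsFrontal T where
  nodes_subset := fun x hx => hC.nodes_subset (by rw [h.nodes_eq]; exact Or.inl hx)
  inc_eq := fun e he => by
    rw [hC.inc_eq e (by rw [h.edges_eq]; exact Or.inl he), h.inc_of_left he]
  front_eq := h.front_eq ▸ hC.front_eq
  rear_mem := fun x hx hr => by
    have h1 := hC.rear_mem x (by rw [h.nodes_eq]; exact Or.inl hx) hr
    rw [h.rear_eq] at h1
    have h2 : x ∈ G.nodes ∩ H.nodes := ⟨hx, H.rear_mem x h1⟩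
    rwa [h.nodes_inter] at h2

theorem inner_disjoint (h : G.IsConcat H C) {x : ν} (hx : x ∈ H.nodes) : x ∉ G.inner := by
  rintro ⟨h1, h2⟩
  have h3 : x ∈ G.nodes ∩ H.nodes := ⟨h1, hx⟩
  rw [h.nodes_inter] at h3
  exact h2 h3

theorem isFrontal_right (h : G.IsConcat H C) (hC : C.IsFrontal T) :
    H.IsFrontal (T.cut G (h.isFrontal_left hC)) where
  nodes_subset := fun x hx =>
    ⟨hC.nodes_subset (by rw [h.nodes_eq]; exact Or.inr hx), h.inner_disjoint hx⟩
  inc_eq := fun e he => by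
    obtain ⟨a, ha⟩ := Option.ne_none_iff_exists'.1 he
    rw [ha, cut_inc_eq_some]
    refine ⟨?_, fun h' => Set.disjoint_left.1 h.edges_disjoint h' he, fun x hx => ?_⟩
    · rw [hC.inc_eq e (by rw [h.edges_eq]; exact Or.inr he), h.inc_of_right he, ha]
    · exact h.inner_disjoint (H.inc_mem e a.1 a.2 ha x hx)
  front_eq := h.interface_eq.symm
  rear_mem := fun x hx hr => by
    rw [← h.rear_eq]
    exact hC.rear_mem x (by rw [h.nodes_eq]; exact Or.inr hx) hr

theorem cut_cut (h : G.IsConcat H C) (hC : C.IsFrontal T) (hG : G.IsFrontal T)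
    (hH : H.IsFrontal (T.cut G hG)) : (T.cut G hG).cut H hH = T.cut C hC := by
  refine Graph.ext ?_ (funext fun e => Option.ext fun a => ?_) h.rear_eq.symm rfl
  · change (T.nodes \ G.inner) \ H.inner = T.nodes \ C.inner
    rw [h.inner_eq, Set.sdiff_sdiff]
  · rw [cut_inc_eq_some, cut_inc_eq_some, cut_inc_eq_some, h.inner_eq, h.edges_eq]
    simp only [Set.mem_union, not_or]
    constructor
    · rintro ⟨⟨h1, h2, h3⟩, h4, h5⟩
      exact ⟨h1, ⟨h2, h4⟩, fun x hx => ⟨h3 x hx, h5 x hx⟩⟩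
    · rintro ⟨h1, ⟨h2, h4⟩, h3⟩
      exact ⟨⟨h1, h2, fun x hx => (h3 x hx).1⟩, h4, fun x hx => (h3 x hx).2⟩

end IsConcat

/-- The union of `G` and `H` with the front of `G` and the rear of `H`.  This is the concatenation
if the two graphs share the interface only. -/
def glue (G H : Graph Voc ν ε) : Graph Voc ν ε where
  nodes := G.nodes ∪ H.nodes
  inc e := (G.inc e).or (H.inc e)
  front := G.front
  rear := H.rear
  nodes_finite := G.nodes_finite.union H.nodes_finite
  edges_finite := by
    refine (Set.Finite.union G.edges_finite H.edges_finite).subset fun e he => ?_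
    simp only [Set.mem_ofPred_eq, Set.mem_union] at he ⊢
    cases h : G.inc e <;> simp_all
  inc_mem e a s he x hx := by
    cases h : G.inc e with
    | none => exact Or.inr (H.inc_mem e a s (by simpa [h] using he) x hx)
    | some b => exact Or.inl (G.inc_mem e a s (by simpa [h] using he) x hx)
  inc_rank e a s he := by
    cases h : G.inc e with
    | none => exact H.inc_rank e a s (by simpa [h] using he)
    | some b => exact G.inc_rank e a s (by simpa [h] using he)
  front_mem x hx := Or.inl (G.front_mem x hx)
  rear_mem x hx := Or.inr (H.rear_mem x hx)
  front_nodup := G.front_nodup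
  rear_nodup := H.rear_nodup

theorem isConcat_glue {T G H : Graph Voc ν ε} (hG : G.IsFrontal T)
    (hH : H.IsFrontal (T.cut G hG)) : G.IsConcat H (glue G H) where
  interface_eq := hH.front_eq.symm
  nodes_inter := by
    ext x
    constructor
    · rintro ⟨h1, h2⟩
      by_contra h3
      exact (hH.nodes_subset h2).2 ⟨h1, h3⟩
    · intro h
      refine ⟨G.rear_mem x h, H.front_mem x ?_⟩
      rw [hH.front_eq]
      exact h
  edges_disjoint := by
    rw [Set.disjoint_left]
    intro e h1 h2
    obtain ⟨a, ha⟩ := Option.ne_none_iff_exists'.1 h2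
    have h3 := hH.inc_eq e h2
    rw [ha, cut_inc_eq_some] at h3
    exact h3.2.1 h1
  nodes_eq := rfl
  inc_eq := fun _ => rfl
  front_eq := rfl
  rear_eq := rfl

theorem isFrontal_glue {T G H : Graph Voc ν ε} (hG : G.IsFrontal T)
    (hH : H.IsFrontal (T.cut G hG)) : (glue G H).IsFrontal T where
  nodes_subset := Set.union_subset hG.nodes_subset fun _ hx => (hH.nodes_subset hx).1
  inc_eq := fun e he => by
    have hc := isConcat_glue hG hH
    rw [hc.edges_eq] at he
    rcases he with he | he
    · rw [hc.inc_of_left he, hG.inc_eq e he]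
    · rw [hc.inc_of_right he]
      obtain ⟨a, ha⟩ := Option.ne_none_iff_exists'.1 he
      have h3 := hH.inc_eq e he
      rw [ha, cut_inc_eq_some] at h3
      rw [h3.1, ha]
  front_eq := hG.front_eq
  rear_mem := fun x hx hr => by
    refine hH.rear_mem x (hx.elim (fun h => ?_) id) hr
    refine H.front_mem x ?_
    rw [hH.front_eq]
    exact hG.rear_mem x h hr

/-- Cutting off a concatenation amounts to cutting off its parts one after the other. -/
theorem cuts_langConcat {L M : Set (Graph Voc ν ε)} {T T' : Graph Voc ν ε} :
    Cuts (langConcat L M) T T' ↔ ∃ T₁, Cuts L T T₁ ∧ Cuts M T₁ T' := by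
  constructor
  · rintro ⟨C, ⟨G, hG, H, hH, h⟩, hC, rfl⟩
    exact ⟨_, ⟨G, hG, h.isFrontal_left hC, rfl⟩, H, hH, h.isFrontal_right hC,
      (h.cut_cut hC _ _).symm⟩
  · rintro ⟨_, ⟨G, hG, h, rfl⟩, H, hH, h', rfl⟩
    exact ⟨glue G H, ⟨G, hG, H, hH, isConcat_glue h h'⟩,
      isFrontal_glue h h', (isConcat_glue h h').cut_cut _ h h'⟩

theorem IsIdentity.cut_eq {n : ℕ} {P T : Graph Voc ν ε} (hP : IsIdentity n P)
    (h : P.IsFrontal T) : T.cut P h = T := by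
  obtain ⟨h1, h2, h3, -⟩ := hP
  have hi : P.inner = ∅ := by
    ext x
    simp only [inner, h2, ← h3, Set.mem_ofPred_eq, Set.mem_empty_iff_false, iff_false]
    tauto
  refine Graph.ext ?_ (funext fun e => Option.ext fun a => ?_) ?_ rfl
  · change T.nodes \ P.inner = T.nodes
    rw [hi, Set.sdiff_empty]
  · rw [cut_inc_eq_some, hi, h1]
    simp
  · change P.rear = T.front
    rw [← h3, h.front_eq]

/-- The identity graph on a repetition-free list of nodes. -/
def idOn (Voc : RankedSet.{u}) {ν : Type v} (ε : Type w) (l : List ν) (hl : l.Nodup) :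
    Graph Voc ν ε where
  nodes := {x | x ∈ l}
  inc _ := none
  front := l
  rear := l
  nodes_finite := l.finite_toSet
  edges_finite := by simp
  inc_mem := by simp
  inc_rank := by simp
  front_mem _ h := h
  rear_mem _ h := h
  front_nodup := hl
  rear_nodup := hl

theorem isIdentity_idOn {l : List ν} (hl : l.Nodup) :
    (idOn Voc ε l hl).IsIdentity l.length := by
  refine ⟨?_, rfl, rfl, rfl⟩
  ext e
  simp [edges, idOn]

theorem isFrontal_idOn (T : Graph Voc ν ε) : (idOn Voc ε T.front T.front_nodup).IsFrontal T where
  nodes_subset := T.front_mem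
  inc_eq := fun e he => by simp [edges, idOn] at he
  front_eq := rfl
  rear_mem := fun _ hx _ => hx

theorem cuts_identity {n : ℕ} {T T' : Graph Voc ν ε} :
    Cuts {P | IsIdentity n P} T T' ↔ T.front.length = n ∧ T' = T := by
  constructor
  · rintro ⟨P, hP, h, rfl⟩
    exact ⟨h.front_eq ▸ hP.2.2.2, IsIdentity.cut_eq hP h⟩
  · rintro ⟨rfl, rfl⟩
    exact ⟨_, isIdentity_idOn T'.front_nodup, isFrontal_idOn T',
      ((isIdentity_idOn T'.front_nodup).cut_eq _).symm⟩

/-- Cutting off an iterated concatenation: either nothing happens, or the first factor is cut off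
and then the iteration of the others. -/
theorem cuts_langStar {i : ℕ} {L : Set (Graph Voc ν ε)} {T T' : Graph Voc ν ε} :
    Cuts {P | LangStar i L P} T T' ↔
      (T.front.length = i ∧ T' = T) ∨ ∃ T₁, Cuts L T T₁ ∧ Cuts {P | LangStar i L P} T₁ T' := by
  rw [← cuts_identity, ← cuts_langConcat]
  constructor
  · rintro ⟨P, hP, h⟩
    cases hP with
    | identity _ hi => exact Or.inl ⟨P, hi, h⟩
    | concat G H _ hG hH hc => exact Or.inr ⟨P, ⟨G, hG, H, hH, hc⟩, h⟩
  · rintro (h | h)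
    · exact h.mono fun P hP => .identity P hP
    · refine h.mono ?_
      rintro P ⟨G, hG, H, hH, hc⟩
      exact .concat G H P hG hH hc

/-! ### Isomorphic copies -/

/-- A bijection between repetition-free lists extends to a function on all nodes. -/
theorem exists_map_eq [Nonempty ν] {l l' : List ν} (hl : l.Nodup) (h : l.length = l'.length) :
    ∃ f : ν → ν, l.map f = l' := by
  classical
  induction l generalizing l' with
  | nil => exact ⟨id, by cases l' <;> simp_all⟩
  | cons a l ih =>
    cases l' with
    | nil => simp at h
    | cons b l' =>
      obtain ⟨f, hf⟩ := ih hl.of_cons (by simpa using h)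
      refine ⟨Function.update f a b, ?_⟩
      simp only [List.map_cons, Function.update_self, List.cons.injEq, true_and]
      rw [← hf]
      refine List.map_congr_left fun x hx => Function.update_of_ne ?_ _ _
      rintro rfl
      exact (List.nodup_cons.1 hl).1 hx

/-- An identity graph on `n` nodes. -/
noncomputable def idGraph (Voc : RankedSet.{u}) (ν : Type v) (ε : Type w) [Infinite ν] (n : ℕ) :
    Graph Voc ν ε :=
  idOn Voc ε ((List.range n).map (Infinite.natEmbedding ν))
    (List.nodup_range.map (Infinite.natEmbedding ν).injective)

theorem hasType_idGraph [Infinite ν] (n : ℕ) : (idGraph Voc ν ε n).HasType n n := by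
  simp [idGraph, idOn, HasType]

theorem isIdentity_of_isomorphic {n : ℕ} {G H : Graph Voc ν ε} (hG : G.IsIdentity n)
    (h : G.Isomorphic H) : H.IsIdentity n := by
  obtain ⟨f, g, hf, hg, -, hfr, hre⟩ := h
  obtain ⟨h1, h2, h3, h4⟩ := hG
  refine ⟨?_, ?_, by rw [hfr, hre, h3], by rw [hfr, List.length_map, h4]⟩
  · rw [← hg.image_eq, h1, Set.image_empty]
  · rw [← hf.image_eq, h2, hfr]
    ext x
    simp

/-- This makes cutting off the fixed graph `idGraph` possible at every front. -/
theorem isomorphic_idOn [Nonempty ν] {l l' : List ν} (hl : l.Nodup) (hl' : l'.Nodup)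
    (h : l.length = l'.length) : (idOn Voc ε l hl).Isomorphic (idOn Voc ε l' hl') := by
  obtain ⟨f, rfl⟩ := exists_map_eq hl h
  refine ⟨f, id, ⟨fun x hx => List.mem_map_of_mem hx, fun x hx y hy => ?_, ?_⟩, ?_, ?_, rfl, rfl⟩
  · exact List.inj_on_of_nodup_map hl' hx hy
  · intro y hy
    exact List.mem_map.1 hy
  · simp [edges, idOn]
  · simp [idOn]

theorem cuts_idGraph [Infinite ν] {n : ℕ} {T T' : Graph Voc ν ε} :
    Cuts {P | (idGraph Voc ν ε n).Isomorphic P} T T' ↔ T.front.length = n ∧ T' = T := by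
  constructor
  · refine fun h => cuts_identity.1 (h.mono fun P hP => isIdentity_of_isomorphic ?_ hP)
    simpa [idGraph] using isIdentity_idOn (Voc := Voc) (ε := ε) (List.nodup_range.map
      (Infinite.natEmbedding ν).injective : ((List.range n).map (Infinite.natEmbedding ν)).Nodup)
  · rintro ⟨rfl, rfl⟩
    exact ⟨_, isomorphic_idOn _ _ (by simp), isFrontal_idOn T',
      ((isIdentity_idOn T'.front_nodup).cut_eq _).symm⟩

theorem Isomorphic.hasType {G H : Graph Voc ν ε} (h : G.Isomorphic H) {m n : ℕ}
    (hG : G.HasType m n) : H.HasType m n := by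
  obtain ⟨f, g, -, -, -, hf, hr⟩ := h
  exact ⟨by rw [hf, List.length_map, hG.1], by rw [hr, List.length_map, hG.2]⟩

/-! ### Progress -/

/-- Cutting off `G` removes an edge or a node. -/
def Progress (G : Graph Voc ν ε) : Prop := G.edges.Nonempty ∨ G.inner.Nonempty

theorem Isomorphic.progress_iff {G H : Graph Voc ν ε} (h : G.Isomorphic H) :
    H.Progress ↔ G.Progress := by
  obtain ⟨f, g, hf, hg, -, -, hr⟩ := h
  have h1 : H.edges.Nonempty ↔ G.edges.Nonempty := by rw [← hg.image_eq, Set.image_nonempty]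
  have h2 : H.inner.Nonempty ↔ G.inner.Nonempty := by
    have : H.inner = f '' G.inner := by
      ext y
      simp only [inner, Set.mem_ofPred_eq, Set.mem_image, ← hf.image_eq, hr, List.mem_map]
      constructor
      · rintro ⟨⟨x, hx, rfl⟩, h⟩
        exact ⟨x, ⟨hx, fun hx' => h ⟨x, hx', rfl⟩⟩, rfl⟩
      · rintro ⟨x, ⟨hx, hx'⟩, rfl⟩
        refine ⟨⟨x, hx, rfl⟩, ?_⟩
        rintro ⟨x', hx1, hx2⟩
        exact hx' (hf.injOn (G.rear_mem x' hx1) hx hx2 ▸ hx1)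
    rw [this, Set.image_nonempty]
  rw [Progress, Progress, h1, h2]

/-- The number of nodes and edges. -/
noncomputable def weight (G : Graph Voc ν ε) : ℕ := G.nodes.ncard + G.edges.ncard

theorem cut_edges_subset {T P : Graph Voc ν ε} (h : P.IsFrontal T) :
    (T.cut P h).edges ⊆ T.edges \ P.edges := by
  intro e he
  obtain ⟨a, ha⟩ := Option.ne_none_iff_exists'.1 he
  rw [cut_inc_eq_some] at ha
  exact ⟨by simp [edges, ha.1], ha.2.1⟩

theorem weight_cut_le {T P : Graph Voc ν ε} (h : P.IsFrontal T) : (T.cut P h).weight ≤ T.weight :=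
  Nat.add_le_add (Set.ncard_le_ncard Set.sdiff_subset T.nodes_finite)
    (Set.ncard_le_ncard ((cut_edges_subset h).trans Set.sdiff_subset) T.edges_finite)

theorem weight_cut_lt {T P : Graph Voc ν ε} (h : P.IsFrontal T) (hP : P.Progress) :
    (T.cut P h).weight < T.weight := by
  have h1 : (T.cut P h).nodes.ncard ≤ T.nodes.ncard :=
    Set.ncard_le_ncard Set.sdiff_subset T.nodes_finite
  have h2 : (T.cut P h).edges.ncard ≤ T.edges.ncard :=
    Set.ncard_le_ncard ((cut_edges_subset h).trans Set.sdiff_subset) T.edges_finite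
  rcases hP with ⟨e, he⟩ | ⟨x, hx⟩
  · refine Nat.add_lt_add_of_le_of_lt h1 (Set.ncard_lt_ncard ⟨(cut_edges_subset h).trans
      Set.sdiff_subset, fun hs => ?_⟩ T.edges_finite)
    have : e ∈ T.edges := by
      change T.inc e ≠ none
      rw [h.inc_eq e he]
      exact he
    exact (cut_edges_subset h (hs this)).2 he
  · refine Nat.add_lt_add_of_lt_of_le (Set.ncard_lt_ncard ⟨Set.sdiff_subset, fun hs => ?_⟩
      T.nodes_finite) h2
    exact (hs (h.nodes_subset hx.1)).2 hx

/-- `T'` differs from `T` in the front only, which may have been enlarged and rearranged. -/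
structure Idle (T T' : Graph Voc ν ε) : Prop where
  nodes_eq : T'.nodes = T.nodes
  inc_eq : T'.inc = T.inc
  rear_eq : T'.rear = T.rear
  front_subset : T.front ⊆ T'.front

theorem Idle.refl (T : Graph Voc ν ε) : Idle T T := ⟨rfl, rfl, rfl, fun _ h => h⟩

theorem Idle.trans {T T' T'' : Graph Voc ν ε} (h : Idle T T') (h' : Idle T' T'') : Idle T T'' :=
  ⟨h'.nodes_eq.trans h.nodes_eq, h'.inc_eq.trans h.inc_eq, h'.rear_eq.trans h.rear_eq,
    fun _ hx => h'.front_subset (h.front_subset hx)⟩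

theorem idle_cut {T P : Graph Voc ν ε} (h : P.IsFrontal T) (hP : ¬ P.Progress) :
    Idle T (T.cut P h) := by
  simp only [Progress, not_or, Set.not_nonempty_iff_eq_empty] at hP
  obtain ⟨he, hi⟩ := hP
  refine ⟨?_, funext fun e => Option.ext fun a => ?_, rfl, fun x hx => ?_⟩
  · change T.nodes \ P.inner = T.nodes
    rw [hi, Set.sdiff_empty]
  · rw [cut_inc_eq_some, hi, he]
    simp
  · rw [← h.front_eq] at hx
    by_contra hr
    have : x ∈ P.inner := ⟨P.front_mem x hx, hr⟩
    rw [hi] at this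
    exact this

end Graph

open GraphForm.Graph

theorem GraphExpr.hasType_of_mem_lang {Voc : RankedSet.{u}} {ν : Type v} {ε : Type w} {m n : ℕ}
    (e : GraphExpr Voc ν ε m n) : ∀ P ∈ e.lang, P.HasType m n := by
  induction e with
  | empty => exact fun P hP => hP.elim
  | graph G h => exact fun P hP => Isomorphic.hasType hP h
  | union a b iha ihb => exact fun P hP => hP.elim (iha P) (ihb P)
  | concat a b iha ihb =>
    rintro C ⟨G, hG, H, hH, h⟩
    exact ⟨h.front_eq ▸ (iha G hG).1, h.rear_eq ▸ (ihb H hH).2⟩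
  | star a iha =>
    intro P hP
    induction hP with
    | identity G h => exact ⟨h.2.2.2, h.2.2.1 ▸ h.2.2.2⟩
    | concat G H C hG _ h ih => exact ⟨h.front_eq ▸ (iha G hG).1, h.rear_eq ▸ ih.2⟩

/-! ### Configurations and languages -/

variable {Voc : RankedSet.{u}} {ν : Type v} {ε : Type w}

namespace GraphAutomaton

/-- The evaluation graph of all configurations, reachable or not. -/
def evalGraph (A : GraphAutomaton.{u, v, w, z} Voc ν ε) : EvalGraph where
  Node := A.Config
  Edge := A.Step
  Universal c := c.state ∈ A.universal

theorem finite_setOf_step (A : GraphAutomaton.{u, v, w, z} Voc ν ε) (c : A.Config) :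
    {d | A.Step c d}.Finite := by
  have := A.Q.finite
  refine ((Set.finite_univ (α := A.Q)).prod (finite_setOf_cuts Set.univ c.graph)).of_injOn
    (f := fun d : A.Config => (d.state, d.graph)) ?_ ?_
  · rintro d ⟨Γ, P, -, -, h, hd⟩
    exact ⟨trivial, P, trivial, h, hd⟩
  · rintro ⟨q, G, h⟩ - ⟨q', G', h'⟩ - heq
    simp only [Prod.mk.injEq] at heq
    obtain ⟨rfl, rfl⟩ := heq
    rfl

theorem value_eq_some_iff (A : GraphAutomaton.{u, v, w, z} Voc ν ε) (G : Graph Voc ν ε)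
    (h : G.front.length = A.Q.rank A.start) (b : Bool) :
    A.value G h = some b ↔ A.evalGraph.Val ⟨A.start, G, h⟩ b := by
  refine (EvalGraph.final_eq_some_iff_val _ (fun c => ?_) _ b).trans
    (EvalGraph.val_reachable_iff A.evalGraph
      (fun c => Relation.ReflTransGen A.Step ⟨A.start, G, h⟩ c) (fun c d hc hd => hc.tail hd) _ b)
  exact Set.Finite.preimage (s := {d | A.Step c.1 d}) Subtype.val_injective.injOn
    (A.finite_setOf_step c.1)

theorem step_iff (A : GraphAutomaton.{u, v, w, z} Voc ν ε) (c d : A.Config) :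
    A.Step c d ↔ ∃ Γ, (c.state, Γ, d.state) ∈ A.Δ ∧ Cuts {P | Γ.Isomorphic P} c.graph d.graph :=
  ⟨fun ⟨Γ, P, h, hP, hc⟩ => ⟨Γ, h, P, hP, hc⟩, fun ⟨Γ, h, P, hP, hc⟩ => ⟨Γ, P, h, hP, hc⟩⟩

end GraphAutomaton

namespace Formula

variable {X : RankedSet.{z}}

/-- The formulas to which a step from a configuration with the given formula can lead. -/
def succs (F : FormulaSystem Voc ν ε X) : {m : ℕ} → Formula Voc ν ε X m →
    Set (Σ m, Formula Voc ν ε X m)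
  | _, .tt => ∅
  | _, .ff => ∅
  | _, .var x _ => {⟨_, F x⟩}
  | _, .ex _ fo => {⟨_, fo⟩}
  | _, .all _ fo => {⟨_, fo⟩}
  | _, .neg fo => {⟨_, fo⟩}
  | _, .and fo₁ fo₂ => {⟨_, fo₁⟩, ⟨_, fo₂⟩}
  | _, .or fo₁ fo₂ => {⟨_, fo₁⟩, ⟨_, fo₂⟩}

theorem finite_succs (F : FormulaSystem Voc ν ε X) {m : ℕ} (fo : Formula Voc ν ε X m) :
    (fo.succs F).Finite := by
  cases fo <;> simp [succs]

end Formula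

namespace FormulaSystem

variable {X : RankedSet.{z}}

/-- The evaluation graph of all formula configurations, reachable or not. -/
def evalGraph (F : FormulaSystem Voc ν ε X) : EvalGraph where
  Node := FormulaConfig Voc ν ε X
  Edge := F.Step
  Universal c := c.Universal

theorem Step.mem_succs {F : FormulaSystem Voc ν ε X} {c d : FormulaConfig Voc ν ε X}
    (h : F.Step c d) : ⟨d.arity, d.formula⟩ ∈ c.formula.succs F ∧
      (d.graph = c.graph ∨ Cuts Set.univ c.graph d.graph) := by
  cases h with
  | ex e fo G s h P hP hf h' => exact ⟨by simp [Formula.succs], Or.inr ⟨P, trivial, hf, rfl⟩⟩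
  | all e fo G s h P hP hf h' => exact ⟨by simp [Formula.succs], Or.inr ⟨P, trivial, hf, rfl⟩⟩
  | _ => exact ⟨by simp [Formula.succs], Or.inl rfl⟩

theorem finite_setOf_step (F : FormulaSystem Voc ν ε X) (c : FormulaConfig Voc ν ε X) :
    {d | F.Step c d}.Finite := by
  have h1 : (Set.univ : Set Sign).Finite :=
    (Set.toFinite {Sign.pos, Sign.neg}).subset fun s _ => by cases s <;> simp
  refine ((c.formula.finite_succs F).prod (h1.prod ((Set.finite_singleton c.graph).union
    (finite_setOf_cuts Set.univ c.graph)))).of_injOn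
    (f := fun d : FormulaConfig Voc ν ε X => (⟨d.arity, d.formula⟩, d.sign, d.graph)) ?_ ?_
  · exact fun d hd => ⟨hd.mem_succs.1, trivial, hd.mem_succs.2⟩
  · rintro ⟨m, fo, G, s, h⟩ - ⟨m', fo', G', s', h'⟩ - heq
    simp only [Prod.mk.injEq, Sigma.mk.injEq] at heq
    obtain ⟨⟨rfl, h1⟩, rfl, rfl⟩ := heq
    cases h1
    rfl

theorem value_eq_some_iff (F : FormulaSystem Voc ν ε X) (x : X) (G : Graph Voc ν ε)
    (h : G.front.length = X.rank x) (b : Bool) :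
    F.value x G h = some b ↔ F.evalGraph.Val (initialConfig x G h) b := by
  refine (EvalGraph.final_eq_some_iff_val _ (fun c => ?_) _ b).trans
    (EvalGraph.val_reachable_iff F.evalGraph
      (fun c => Relation.ReflTransGen F.Step (initialConfig x G h) c)
      (fun c d hc hd => hc.tail hd) _ b)
  exact (F.finite_setOf_step c.1).preimage Subtype.val_injective.injOn

/-- A formula system and an automaton whose evaluations agree have the same languages. -/
theorem languages_eq (F : FormulaSystem Voc ν ε X) (x : X)
    (A : GraphAutomaton.{u, v, w, z} Voc ν ε) (hr : X.rank x = A.Q.rank A.start)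
    (H : ∀ (G : Graph Voc ν ε) (h : G.front.length = X.rank x)
      (h' : G.front.length = A.Q.rank A.start) (b : Bool),
      F.evalGraph.Val (initialConfig x G h) b ↔ A.evalGraph.Val ⟨A.start, G, h'⟩ b) :
    F.lowerLanguage x = A.lowerLanguage ∧ F.upperLanguage x = A.upperLanguage := by
  have key : ∀ G h h' b, F.value x G h = some b ↔ A.value G h' = some b := fun G h h' b => by
    rw [value_eq_some_iff, GraphAutomaton.value_eq_some_iff]
    exact H G h h' b
  constructor <;> ext G
  · exact ⟨fun ⟨h, hv⟩ => ⟨h.trans hr, (key G h _ true).1 hv⟩,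
      fun ⟨h, hv⟩ => ⟨h.trans hr.symm, (key G _ h true).2 hv⟩⟩
  · exact ⟨fun ⟨h, hv⟩ => ⟨h.trans hr, fun hf => hv ((key G h _ false).2 hf)⟩,
      fun ⟨h, hv⟩ => ⟨h.trans hr.symm, fun hf => hv ((key G _ h false).1 hf)⟩⟩

end FormulaSystem

/-! ### From automata to formula systems -/

namespace Formula

variable {X : RankedSet.{z}} {m i : ℕ}

/-- The quantifier of the given kind (`true` for universal). -/
def quant : Bool → GraphExpr Voc ν ε m i → Formula Voc ν ε X i → Formula Voc ν ε X m
  | true => .all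
  | false => .ex

/-- The binary junctor of the given kind (`true` for conjunction). -/
def join : Bool → Formula Voc ν ε X m → Formula Voc ν ε X m → Formula Voc ν ε X m
  | true => .and
  | false => .or

/-- The iterated junction of the given kind. -/
def joinList (k : Bool) : List (Formula Voc ν ε X m) → Formula Voc ν ε X m
  | [] => match k with
    | true => .tt
    | false => .ff
  | fo :: l => join k fo (joinList k l)

theorem conjunctive_quant (k : Bool) (e : GraphExpr Voc ν ε m i) (fo : Formula Voc ν ε X i) :
    (quant k e fo).Conjunctive ↔ k = true := by
  cases k <;> simp [quant, Conjunctive]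

theorem conjunctive_joinList (k : Bool) (l : List (Formula Voc ν ε X m)) :
    (joinList k l).Conjunctive ↔ k = true := by
  cases k <;> cases l <;> simp [joinList, join, Conjunctive]

/-- The number of junctors and quantifiers. -/
def size : {m : ℕ} → Formula Voc ν ε X m → ℕ
  | _, .tt => 0
  | _, .ff => 0
  | _, .var _ _ => 0
  | _, .ex _ fo => fo.size + 1
  | _, .all _ fo => fo.size + 1
  | _, .neg fo => fo.size + 1
  | _, .and fo₁ fo₂ => fo₁.size + fo₂.size + 1
  | _, .or fo₁ fo₂ => fo₁.size + fo₂.size + 1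

end Formula

namespace FormulaSystem

variable {X : RankedSet.{z}} {F : FormulaSystem Voc ν ε X} {m i : ℕ} {G : Graph Voc ν ε}
  {s : Sign} {d : FormulaConfig Voc ν ε X}

theorem step_var_iff (x : X) {h : G.front.length = X.rank x} :
    F.Step ⟨X.rank x, .var x rfl, G, s, h⟩ d ↔ d = ⟨X.rank x, F x, G, s, h⟩ := by
  constructor
  · intro hd
    cases hd
    rfl
  · rintro rfl
    exact .var x rfl G s h h

theorem step_quant_iff {k : Bool} {e : GraphExpr Voc ν ε m i} {fo : Formula Voc ν ε X i}
    {h : G.front.length = m} :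
    F.Step ⟨m, .quant k e fo, G, s, h⟩ d ↔
      ∃ T, ∃ h' : T.front.length = i, Cuts e.lang G T ∧ d = ⟨i, fo, T, s, h'⟩ := by
  constructor
  · intro hd
    cases k <;> cases hd <;> exact ⟨_, _, ⟨_, ‹_›, _, rfl⟩, rfl⟩
  · rintro ⟨_, h', ⟨P, hP, hf, rfl⟩, rfl⟩
    cases k
    · exact .ex e fo G s h P hP hf h'
    · exact .all e fo G s h P hP hf h'

theorem step_join_iff {k : Bool} {fo₁ fo₂ : Formula Voc ν ε X m} {h : G.front.length = m} :
    F.Step ⟨m, .join k fo₁ fo₂, G, s, h⟩ d ↔ d = ⟨m, fo₁, G, s, h⟩ ∨ d = ⟨m, fo₂, G, s, h⟩ := by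
  constructor
  · intro hd
    cases k <;> cases hd <;> simp
  · rintro (rfl | rfl) <;> cases k
    · exact .or_left ..
    · exact .and_left ..
    · exact .or_right ..
    · exact .and_right ..

theorem not_step_joinList_nil {k : Bool} {h : G.front.length = m} :
    ¬ F.Step ⟨m, .joinList k [], G, s, h⟩ d := by
  intro hd
  cases k <;> cases hd

theorem size_lt_of_step {c d : FormulaConfig Voc ν ε X} (hd : F.Step c d)
    (hc : ∀ m x h, (⟨c.arity, c.formula⟩ : Σ m, Formula Voc ν ε X m) ≠ ⟨m, .var x h⟩) :
    d.formula.size < c.formula.size := by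
  cases hd with
  | var x hx G s h h' => exact (hc _ x hx rfl).elim
  | _ => simp only [Formula.size]; omega

end FormulaSystem

namespace GraphAutomaton

variable (A : GraphAutomaton.{u, v, w, z} Voc ν ε)

/-- The transitions that leave the state `q`. -/
abbrev Out (q : A.Q) : Type (max u v w z) := {t : Graph Voc ν ε × A.Q // (q, t.1, t.2) ∈ A.Δ}

theorem finite_out (q : A.Q) : Finite (A.Out q) :=
  (A.finite.preimage (f := fun t : Graph Voc ν ε × A.Q => (q, t.1, t.2))
    (fun _ _ _ _ h => by simpa [Prod.ext_iff] using h)).to_subtype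

open Classical in
/-- The formula for a transition leaving `q`, the states serving as variables. -/
noncomputable def outFormula (q : A.Q) (t : A.Out q) : Formula Voc ν ε A.Q (A.Q.rank q) :=
  .quant (decide (q ∈ A.universal)) (.graph t.1.1 (A.typed _ _ _ t.2)) (.var t.1.2 rfl)

open Classical in
/-- The junction of the formulas for some transitions leaving `q`. -/
noncomputable def outJoin (q : A.Q) (l : List (A.Out q)) : Formula Voc ν ε A.Q (A.Q.rank q) :=
  .joinList (decide (q ∈ A.universal)) (l.map (A.outFormula q))

/-- A list of all transitions leaving `q`. -/
noncomputable def outList (q : A.Q) : List (A.Out q) :=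
  have := A.finite_out q
  have := Fintype.ofFinite (A.Out q)
  Finset.univ.toList

theorem mem_outList (q : A.Q) (t : A.Out q) : t ∈ A.outList q := by
  simp [outList]

/-- The formula system with the states of `A` as variables that describes the transitions of `A`. -/
noncomputable def toFormulaSystem : FormulaSystem Voc ν ε A.Q := fun q => A.outJoin q (A.outList q)

/-- The formula configurations between the one that represents `c` and those that represent its
successors. -/
def Between (c : A.Config) (d : FormulaConfig Voc ν ε A.Q) : Prop :=
  ∃ fo, ((∃ l, fo = A.outJoin c.state l) ∨ ∃ t, fo = A.outFormula c.state t) ∧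
    d = ⟨_, fo, c.graph, Sign.pos, c.typed⟩

theorem Between.ne_var {A : GraphAutomaton.{u, v, w, z} Voc ν ε} {c : A.Config}
    {d : FormulaConfig Voc ν ε A.Q} (hd : A.Between c d) (m : ℕ) (x : A.Q)
    (h : A.Q.rank x = m) : (⟨d.arity, d.formula⟩ : Σ m, Formula Voc ν ε A.Q m) ≠ ⟨m, .var x h⟩ := by
  subst h
  obtain ⟨fo, hfo, rfl⟩ := hd
  intro heq
  simp only [Sigma.mk.injEq] at heq
  obtain ⟨h1, h2⟩ := heq
  have : ∀ {m n : ℕ} {f : Formula Voc ν ε A.Q m} {g : Formula Voc ν ε A.Q n}, m = n → f ≍ g →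
      (∃ x h, g = .var x h) → ∃ x h, f = .var x h := by
    rintro m _ f g rfl h
    cases h
    exact id
  obtain ⟨y, hy, h3⟩ := this h1 h2 ⟨x, rfl, rfl⟩
  rcases hfo with ⟨l, rfl⟩ | ⟨t, rfl⟩
  · cases l <;> by_cases hu : c.state ∈ A.universal <;>
      simp [outJoin, hu, Formula.joinList, Formula.join] at h3
  · by_cases hu : c.state ∈ A.universal <;> simp [outFormula, hu, Formula.quant] at h3

theorem step_outFormula_iff {c : A.Config} {t : A.Out c.state} {d : FormulaConfig Voc ν ε A.Q} :
    A.toFormulaSystem.Step ⟨_, A.outFormula c.state t, c.graph, Sign.pos, c.typed⟩ d ↔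
      ∃ T, ∃ h : T.front.length = A.Q.rank t.1.2, Cuts {P | t.1.1.Isomorphic P} c.graph T ∧
        d = FormulaSystem.initialConfig t.1.2 T h :=
  FormulaSystem.step_quant_iff

/-- A variable is existential whatever the kind of the state, but it has a unique successor, so that
its kind does not matter. -/
theorem refines_toFormulaSystem : EvalGraph.Refines A.evalGraph A.toFormulaSystem.evalGraph
    (fun c n => n = FormulaSystem.initialConfig c.state c.graph c.typed) A.Between where
  kind := by
    rintro c d (rfl | ⟨fo, hfo, rfl⟩)
    · exact Or.inr ⟨_, fun e => FormulaSystem.step_var_iff c.state⟩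
    · left
      have : fo.Conjunctive ↔ c.state ∈ A.universal := by
        rcases hfo with ⟨l, rfl⟩ | ⟨t, rfl⟩
        · rw [outJoin, Formula.conjunctive_joinList]
          simp
        · rw [outFormula, Formula.conjunctive_quant]
          simp
      simpa [FormulaSystem.evalGraph, FormulaConfig.Universal, evalGraph] using this
  sound := by
    rintro c d d' (rfl | ⟨fo, ⟨l, rfl⟩ | ⟨t, rfl⟩, rfl⟩) he
    · exact Or.inl ⟨_, Or.inl ⟨_, rfl⟩, (FormulaSystem.step_var_iff c.state).1 he⟩
    · left
      cases l with
      | nil => exact (FormulaSystem.not_step_joinList_nil he).elim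
      | cons t l =>
        rcases FormulaSystem.step_join_iff.1 he with rfl | rfl
        · exact ⟨_, Or.inr ⟨t, rfl⟩, rfl⟩
        · exact ⟨_, Or.inl ⟨l, rfl⟩, rfl⟩
    · right
      obtain ⟨T, h, hT, rfl⟩ := A.step_outFormula_iff.1 he
      exact ⟨⟨t.1.2, T, h⟩, (A.step_iff _ _).2 ⟨t.1.1, t.2, hT⟩, rfl⟩
  complete := by
    rintro c c' _ rfl he
    refine ⟨_, rfl, ?_⟩
    obtain ⟨Γ, hΓ, hc⟩ := (A.step_iff _ _).1 he
    have key : ∀ l : List (A.Out c.state), ⟨(Γ, c'.state), hΓ⟩ ∈ l →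
        A.toFormulaSystem.evalGraph.Reach (A.Between c)
          ⟨_, A.outJoin c.state l, c.graph, Sign.pos, c.typed⟩
          (FormulaSystem.initialConfig c'.state c'.graph c'.typed) := by
      intro l
      induction l with
      | nil => simp
      | cons t l ih =>
        intro hl
        rcases List.mem_cons.1 hl with rfl | hl
        · exact .step (FormulaSystem.step_join_iff.2 (Or.inl rfl)) ⟨_, Or.inr ⟨_, rfl⟩, rfl⟩
            (.edge (A.step_outFormula_iff.2 ⟨c'.graph, c'.typed, hc, rfl⟩))
        · exact .step (FormulaSystem.step_join_iff.2 (Or.inr rfl)) ⟨_, Or.inl ⟨_, rfl⟩, rfl⟩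
            (ih hl)
    exact .step ((FormulaSystem.step_var_iff c.state).2 rfl) ⟨_, Or.inl ⟨_, rfl⟩, rfl⟩
      (key _ (A.mem_outList _ _))
  wf := by
    refine Subrelation.wf ?_
      (measure fun d : FormulaConfig Voc ν ε A.Q => d.formula.size).wf
    rintro d' d ⟨he, c, hd, -⟩
    exact FormulaSystem.size_lt_of_step he hd.ne_var

theorem toFormulaSystem_languages :
    A.toFormulaSystem.lowerLanguage A.start = A.lowerLanguage ∧
      A.toFormulaSystem.upperLanguage A.start = A.upperLanguage :=
  A.toFormulaSystem.languages_eq A.start A rfl fun G h _ b =>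
    (A.refines_toFormulaSystem.val_iff (c := ⟨A.start, G, h⟩) rfl b).symm

end GraphAutomaton

/-! ### Shortening paths -/

/-- A path from `x` to `y` inside `S` either avoids `x` altogether, or does so after its last visit
to `x`. -/
theorem exists_reflTransGen_avoiding {α : Type*} {R : α → α → Prop} {S : Set α} {x y a : α}
    (hxy : x ≠ y) (h : Relation.ReflTransGen (fun a b => R a b ∧ a ∈ S ∧ b ∈ S) a y) :
    (a ≠ x ∧
      Relation.ReflTransGen (fun a b => R a b ∧ a ∈ S \ {x} ∧ b ∈ S \ {x}) a y) ∨
    ∃ x₁, R x x₁ ∧ x ∈ S ∧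
      Relation.ReflTransGen (fun a b => R a b ∧ a ∈ S \ {x} ∧ b ∈ S \ {x}) x₁ y := by
  induction h using Relation.ReflTransGen.head_induction_on with
  | refl => exact Or.inl ⟨hxy.symm, .refl⟩
  | @head a b hab _ ih =>
    rcases ih with ⟨hb, h⟩ | h
    · by_cases ha : a = x
      · subst ha
        exact Or.inr ⟨b, hab.1, hab.2.1, h⟩
      · exact Or.inl ⟨ha, .head ⟨hab.1, ⟨hab.2.1, ha⟩, hab.2.2, hb⟩ h⟩
    · exact Or.inr h

/-- If `y` is reachable from `x` inside a set of at most `n` elements, then it is so in at most `n`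
steps; these are counted down here. -/
theorem reflTransGen_countdown {α : Type*} {R : α → α → Prop} {C : α × ℕ → α × ℕ → Prop}
    (hC : ∀ a b k, R a b → C (a, k + 1) (b, k)) (n : ℕ) {S : Set α} (hS : S.Finite)
    (hn : S.ncard ≤ n) {x y : α}
    (h : Relation.ReflTransGen (fun a b => R a b ∧ a ∈ S ∧ b ∈ S) x y) :
    ∃ k, Relation.ReflTransGen C (x, n) (y, k) := by
  by_cases hxy : x = y
  · subst hxy
    exact ⟨n, .refl⟩
  obtain ⟨x₁, hx, hxS, h'⟩ := (exists_reflTransGen_avoiding hxy h).resolve_left fun h => h.1 rfl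
  have hlt : (S \ {x}).ncard < S.ncard := Set.ncard_sdiff_singleton_lt_of_mem hxS hS
  cases n with
  | zero => omega
  | succ n =>
    obtain ⟨k, hk⟩ := reflTransGen_countdown hC n (hS.subset Set.sdiff_subset) (by omega) h'
    exact ⟨k, .head (hC _ _ _ hx) hk⟩

/-! ### Subformulas -/

namespace Formula

variable {X : RankedSet.{z}}

/-- The subformulas of a formula. -/
def subs : {m : ℕ} → Formula Voc ν ε X m → Set (Σ m, Formula Voc ν ε X m)
  | m, .tt => {⟨m, .tt⟩}
  | m, .ff => {⟨m, .ff⟩}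
  | _, .var x h => {⟨_, .var x h⟩}
  | _, .ex e fo => insert ⟨_, .ex e fo⟩ fo.subs
  | _, .all e fo => insert ⟨_, .all e fo⟩ fo.subs
  | _, .neg fo => insert ⟨_, .neg fo⟩ fo.subs
  | _, .and fo₁ fo₂ => insert ⟨_, .and fo₁ fo₂⟩ (fo₁.subs ∪ fo₂.subs)
  | _, .or fo₁ fo₂ => insert ⟨_, .or fo₁ fo₂⟩ (fo₁.subs ∪ fo₂.subs)

theorem finite_subs {m : ℕ} (fo : Formula Voc ν ε X m) : fo.subs.Finite := by
  induction fo with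
  | tt | ff | var => exact Set.finite_singleton _
  | ex _ _ ih | all _ _ ih | neg _ ih => exact ih.insert _
  | and _ _ ih₁ ih₂ | or _ _ ih₁ ih₂ => exact (ih₁.union ih₂).insert _

theorem self_mem_subs {m : ℕ} (fo : Formula Voc ν ε X m) : ⟨m, fo⟩ ∈ fo.subs := by
  cases fo <;> simp [subs]

theorem succs_subset_of_mem_subs (F : FormulaSystem Voc ν ε X) {m : ℕ}
    (fo : Formula Voc ν ε X m) {p : Σ m, Formula Voc ν ε X m} (hp : p ∈ fo.subs) :
    p.2.succs F ⊆ fo.subs ∪ ⋃ x, (F x).subs := by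
  induction fo with
  | tt | ff =>
    obtain rfl := hp
    simp [succs]
  | var x h =>
    obtain rfl := hp
    rintro _ rfl
    exact Or.inr (Set.mem_iUnion.2 ⟨x, (F x).self_mem_subs⟩)
  | ex e fo ih | all e fo ih | neg fo ih =>
    rcases hp with rfl | hp
    · rintro _ rfl
      exact Or.inl (Or.inr fo.self_mem_subs)
    · exact (ih hp).trans (Set.union_subset_union_left _ (Set.subset_insert _ _))
  | and fo₁ fo₂ ih₁ ih₂ | or fo₁ fo₂ ih₁ ih₂ =>
    rcases hp with rfl | hp | hp
    · rintro _ (rfl | rfl)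
      · exact Or.inl (Or.inr (Or.inl fo₁.self_mem_subs))
      · exact Or.inl (Or.inr (Or.inr fo₂.self_mem_subs))
    · exact (ih₁ hp).trans (Set.union_subset_union_left _
        (Set.subset_union_left.trans (Set.subset_insert _ _)))
    · exact (ih₂ hp).trans (Set.union_subset_union_left _
        (Set.subset_union_right.trans (Set.subset_insert _ _)))

end Formula

/-- The formulas that occur in the configurations reachable from those at the variable `x`. -/
def FormulaSystem.relevant {X : RankedSet.{z}} (F : FormulaSystem Voc ν ε X) (x : X) :
    Set (Σ m, Formula Voc ν ε X m) :=
  insert ⟨_, .var x rfl⟩ (⋃ y, (F y).subs)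

theorem FormulaSystem.finite_relevant {X : RankedSet.{z}} (F : FormulaSystem Voc ν ε X) (x : X) :
    (F.relevant x).Finite := by
  have := X.finite
  exact (Set.finite_iUnion fun y => (F y).finite_subs).insert _

theorem FormulaSystem.succs_subset_relevant {X : RankedSet.{z}} {F : FormulaSystem Voc ν ε X}
    {x : X} {p : Σ m, Formula Voc ν ε X m} (hp : p ∈ F.relevant x) :
    p.2.succs F ⊆ F.relevant x := by
  refine Set.Subset.trans ?_ (Set.subset_insert _ _)
  rcases hp with rfl | hp
  · rintro _ rfl
    exact Set.mem_iUnion.2 ⟨x, (F x).self_mem_subs⟩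
  · obtain ⟨y, hy⟩ := Set.mem_iUnion.1 hp
    exact ((F y).succs_subset_of_mem_subs F hy).trans
      (Set.union_subset (Set.subset_iUnion (fun y => (F y).subs) y) subset_rfl)

/-! ### Processing graph expressions step by step -/

/-- A stack of graph expressions that remain to be cut off, on top of the formula that is to be
evaluated afterwards. -/
inductive Stack (Voc : RankedSet.{u}) (ν : Type v) (ε : Type w) (X : RankedSet.{z}) :
    ℕ → Type (max u v w z)
  | done {m : ℕ} (fo : Formula Voc ν ε X m) : Stack Voc ν ε X m
  | push {m i : ℕ} (e : GraphExpr Voc ν ε m i) (κ : Stack Voc ν ε X i) : Stack Voc ν ε X m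

namespace Stack

variable {X : RankedSet.{z}}

/-- Elementary steps: cutting off a single graph, or decomposing the topmost expression, in which
case an identity graph is cut off. -/
inductive Step [Infinite ν] :
    (Σ m, Stack Voc ν ε X m) → Graph Voc ν ε → (Σ m, Stack Voc ν ε X m) → Prop
  | graph {m i : ℕ} (G : Graph Voc ν ε) (h : G.HasType m i) (κ : Stack Voc ν ε X i) :
      Step ⟨m, .push (.graph G h) κ⟩ G ⟨i, κ⟩
  | union_left {m i : ℕ} (a b : GraphExpr Voc ν ε m i) (κ : Stack Voc ν ε X i) :
      Step ⟨m, .push (.union a b) κ⟩ (idGraph Voc ν ε m) ⟨m, .push a κ⟩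
  | union_right {m i : ℕ} (a b : GraphExpr Voc ν ε m i) (κ : Stack Voc ν ε X i) :
      Step ⟨m, .push (.union a b) κ⟩ (idGraph Voc ν ε m) ⟨m, .push b κ⟩
  | concat {m i j : ℕ} (a : GraphExpr Voc ν ε m i) (b : GraphExpr Voc ν ε i j)
      (κ : Stack Voc ν ε X j) :
      Step ⟨m, .push (.concat a b) κ⟩ (idGraph Voc ν ε m) ⟨m, .push a (.push b κ)⟩
  | star_stop {m : ℕ} (a : GraphExpr Voc ν ε m m) (κ : Stack Voc ν ε X m) :
      Step ⟨m, .push (.star a) κ⟩ (idGraph Voc ν ε m) ⟨m, κ⟩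
  | star_more {m : ℕ} (a : GraphExpr Voc ν ε m m) (κ : Stack Voc ν ε X m) :
      Step ⟨m, .push (.star a) κ⟩ (idGraph Voc ν ε m) ⟨m, .push a (.push (.star a) κ)⟩

theorem Step.hasType [Infinite ν] {κ κ' : Σ m, Stack Voc ν ε X m} {Γ : Graph Voc ν ε}
    (h : Step κ Γ κ') : Γ.HasType κ.1 κ'.1 := by
  cases h with
  | graph G h κ => exact h
  | _ => exact hasType_idGraph _

/-- The stacks that occur while `e` is processed on top of `κ`. -/
def states : {m i : ℕ} → GraphExpr Voc ν ε m i → Stack Voc ν ε X i → Set (Σ m, Stack Voc ν ε X m)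
  | m, _, .empty, κ => {⟨m, .push .empty κ⟩}
  | _, _, .graph G h, κ => {⟨_, .push (.graph G h) κ⟩}
  | _, _, .union a b, κ => insert ⟨_, .push (.union a b) κ⟩ (states a κ ∪ states b κ)
  | _, _, .concat a b, κ =>
      insert ⟨_, .push (.concat a b) κ⟩ (states a (.push b κ) ∪ states b κ)
  | _, _, .star a, κ => insert ⟨_, .push (.star a) κ⟩ (states a (.push (.star a) κ))

theorem push_mem_states {m i : ℕ} (e : GraphExpr Voc ν ε m i) (κ : Stack Voc ν ε X i) :
    ⟨m, .push e κ⟩ ∈ states e κ := by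
  cases e <;> simp [states]

theorem finite_states {m i : ℕ} (e : GraphExpr Voc ν ε m i) (κ : Stack Voc ν ε X i) :
    (states e κ).Finite := by
  induction e with
  | empty | graph => exact Set.finite_singleton _
  | union _ _ iha ihb => exact ((iha κ).union (ihb κ)).insert _
  | concat _ _ iha ihb => exact ((iha _).union (ihb κ)).insert _
  | star _ iha => exact (iha _).insert _

/-- The stacks in `states e κ` are left towards `κ` only. -/
theorem Step.mem_states [Infinite ν] {m i : ℕ} {e : GraphExpr Voc ν ε m i}
    {κ : Stack Voc ν ε X i} {x y : Σ m, Stack Voc ν ε X m} {Γ : Graph Voc ν ε}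
    (h : Step x Γ y) (hx : x ∈ states e κ) : y ∈ insert ⟨i, κ⟩ (states e κ) := by
  induction e with
  | empty =>
    obtain rfl := hx
    cases h
  | graph G hG =>
    obtain rfl := hx
    cases h
    exact Or.inl rfl
  | union a b iha ihb =>
    rcases hx with rfl | hx | hx
    · cases h
      · exact Or.inr (Or.inr (Or.inl (push_mem_states a κ)))
      · exact Or.inr (Or.inr (Or.inr (push_mem_states b κ)))
    · exact (iha hx).imp_right fun h => Or.inr (Or.inl h)
    · exact (ihb hx).imp_right fun h => Or.inr (Or.inr h)
  | concat a b iha ihb =>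
    rcases hx with rfl | hx | hx
    · cases h
      exact Or.inr (Or.inr (Or.inl (push_mem_states a _)))
    · rcases iha hx with rfl | h
      · exact Or.inr (Or.inr (Or.inr (push_mem_states b κ)))
      · exact Or.inr (Or.inr (Or.inl h))
    · exact (ihb hx).imp_right fun h => Or.inr (Or.inr h)
  | star a iha =>
    rcases hx with rfl | hx
    · cases h
      · exact Or.inl rfl
      · exact Or.inr (Or.inr (push_mem_states a _))
    · rcases iha hx with rfl | h
      · exact Or.inr (Or.inl rfl)
      · exact Or.inr (Or.inr h)

/-- `κ.Sem T p T'`: cutting off the expressions on the stack `κ` one after the other can turn the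
graph `T` into `T'`, and `p` is the formula at the bottom of `κ`. -/
def Sem : {m : ℕ} → Stack Voc ν ε X m → Graph Voc ν ε → (Σ m, Formula Voc ν ε X m) →
    Graph Voc ν ε → Prop
  | _, .done fo, T, p, T' => p = ⟨_, fo⟩ ∧ T' = T
  | _, .push e κ, T, p, T' => ∃ T₁, Cuts e.lang T T₁ ∧ κ.Sem T₁ p T'

/-- Elementary steps are sound for the meaning of stacks. -/
theorem Step.sem [Infinite ν] {x y : Σ m, Stack Voc ν ε X m} {Γ : Graph Voc ν ε}
    (h : Step x Γ y) {T T₁ T' : Graph Voc ν ε} (hT : Cuts {P | Γ.Isomorphic P} T T₁)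
    {p : Σ m, Formula Voc ν ε X m} (hs : y.2.Sem T₁ p T') : x.2.Sem T p T' := by
  cases h with
  | graph G h κ => exact ⟨T₁, hT, hs⟩
  | union_left a b κ =>
    obtain ⟨-, rfl⟩ := cuts_idGraph.1 hT
    obtain ⟨T₂, h, hs⟩ := hs
    exact ⟨T₂, h.mono Set.subset_union_left, hs⟩
  | union_right a b κ =>
    obtain ⟨-, rfl⟩ := cuts_idGraph.1 hT
    obtain ⟨T₂, h, hs⟩ := hs
    exact ⟨T₂, h.mono Set.subset_union_right, hs⟩
  | concat a b κ =>
    obtain ⟨-, rfl⟩ := cuts_idGraph.1 hT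
    obtain ⟨T₂, h, T₃, h', hs⟩ := hs
    exact ⟨T₃, cuts_langConcat.2 ⟨T₂, h, h'⟩, hs⟩
  | star_stop a κ =>
    obtain ⟨hl, rfl⟩ := cuts_idGraph.1 hT
    exact ⟨T₁, cuts_langStar.2 (Or.inl ⟨hl, rfl⟩), hs⟩
  | star_more a κ =>
    obtain ⟨-, rfl⟩ := cuts_idGraph.1 hT
    obtain ⟨T₂, h, T₃, h', hs⟩ := hs
    exact ⟨T₃, cuts_langStar.2 (Or.inr ⟨T₂, h, h'⟩), hs⟩

/-- Elementary steps on pairs of a stack and a graph. -/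
def Move [Infinite ν] (x y : (Σ m, Stack Voc ν ε X m) × Graph Voc ν ε) : Prop :=
  ∃ Γ, Step x.1 Γ y.1 ∧ Cuts {P | Γ.Isomorphic P} x.2 y.2

theorem Move.typed [Infinite ν] {x y : (Σ m, Stack Voc ν ε X m) × Graph Voc ν ε}
    (h : Move x y) : y.2.front.length = y.1.1 := by
  obtain ⟨Γ, h, hc⟩ := h
  exact (hc.front_length fun P hP => Isomorphic.hasType hP h.hasType).2

theorem Step.move [Infinite ν] {m : ℕ} {κ : Stack Voc ν ε X m} {y : Σ m, Stack Voc ν ε X m}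
    {T : Graph Voc ν ε} (h : Step ⟨m, κ⟩ (idGraph Voc ν ε m) y) (hT : T.front.length = m) :
    Move (⟨m, κ⟩, T) (y, T) :=
  ⟨_, h, cuts_idGraph.2 ⟨hT, rfl⟩⟩

/-- Every graph in the language of the topmost expression can be cut off by elementary steps. -/
theorem reflTransGen_move [Infinite ν] {m i : ℕ} (e : GraphExpr Voc ν ε m i)
    (κ : Stack Voc ν ε X i) {T T' : Graph Voc ν ε} (h : Cuts e.lang T T') :
    Relation.ReflTransGen Move (⟨m, .push e κ⟩, T) (⟨i, κ⟩, T') := by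
  have hl := (h.front_length e.hasType_of_mem_lang).1
  induction e generalizing T T' with
  | empty =>
    obtain ⟨P, hP, -⟩ := h
    exact hP.elim
  | graph G hG => exact .single ⟨G, .graph G hG κ, h⟩
  | union a b iha ihb =>
    obtain ⟨P, hP | hP, h⟩ := h
    · exact .head ((Step.union_left a b κ).move hl) (iha κ ⟨P, hP, h⟩ hl)
    · exact .head ((Step.union_right a b κ).move hl) (ihb κ ⟨P, hP, h⟩ hl)
  | concat a b iha ihb =>
    obtain ⟨T₁, h₁, h₂⟩ := cuts_langConcat.1 h
    exact .head ((Step.concat a b κ).move hl)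
      ((iha _ h₁ hl).trans (ihb κ h₂ (h₁.front_length a.hasType_of_mem_lang).2))
  | @star i a iha =>
    obtain ⟨P, hP, hf, rfl⟩ := h
    replace hP : LangStar i a.lang P := hP
    induction hP generalizing T with
    | identity P hP =>
      rw [hP.cut_eq hf]
      exact .single ((Step.star_stop a κ).move hl)
    | concat G H C hG hH hc ih =>
      have h₁ : Cuts a.lang T (T.cut G (hc.isFrontal_left hf)) := ⟨G, hG, _, rfl⟩
      rw [← hc.cut_cut hf _ (hc.isFrontal_right hf)]
      exact .head ((Step.star_more a κ).move hl)
        ((iha _ h₁ hl).trans (ih (h₁.front_length a.hasType_of_mem_lang).2 (hc.isFrontal_right hf)))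

/-- Elementary steps with a counter.  Every step may decrease the counter; a step that removes a
node or an edge may also reset it to `N`. -/
def CountedMove [Infinite ν] (N : ℕ) (x y : ((Σ m, Stack Voc ν ε X m) × Graph Voc ν ε) × ℕ) :
    Prop :=
  ∃ Γ, Step x.1.1 Γ y.1.1 ∧ Cuts {P | Γ.Isomorphic P} x.1.2 y.1.2 ∧
    (x.2 = y.2 + 1 ∨ Γ.Progress ∧ y.2 = N)

/-- Elementary steps that remove neither a node nor an edge. -/
def IdleMove [Infinite ν] (x y : (Σ m, Stack Voc ν ε X m) × Graph Voc ν ε) : Prop :=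
  ∃ Γ, Step x.1 Γ y.1 ∧ Cuts {P | Γ.Isomorphic P} x.2 y.2 ∧ ¬ Γ.Progress

theorem IdleMove.move [Infinite ν] {x y : (Σ m, Stack Voc ν ε X m) × Graph Voc ν ε}
    (h : IdleMove x y) : Move x y := by
  obtain ⟨Γ, h, hc, -⟩ := h
  exact ⟨Γ, h, hc⟩

theorem IdleMove.idle [Infinite ν] {x y : (Σ m, Stack Voc ν ε X m) × Graph Voc ν ε}
    (h : IdleMove x y) : Idle x.2 y.2 := by
  obtain ⟨Γ, -, ⟨P, hP, hf, hy⟩, hΓ⟩ := h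
  rw [hy]
  exact idle_cut hf fun h => hΓ ((Isomorphic.progress_iff hP).1 h)

theorem idle_of_reflTransGen [Infinite ν] {x y : (Σ m, Stack Voc ν ε X m) × Graph Voc ν ε}
    (h : Relation.ReflTransGen IdleMove x y) : Idle x.2 y.2 := by
  induction h with
  | refl => exact Idle.refl _
  | tail _ h ih => exact ih.trans h.idle

/-- The pairs of a stack in `K` and a graph from which `T` can result without removing anything. -/
def idleSources (K : Set (Σ m, Stack Voc ν ε X m)) (T : Graph Voc ν ε) :
    Set ((Σ m, Stack Voc ν ε X m) × Graph Voc ν ε) :=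
  {z | z.1 ∈ K ∧ z.2.front.length = z.1.1 ∧ Idle z.2 T}

/-- The number of `idleSources` is bounded independently of the graph, since each of them is
determined by the stack and the positions of its front nodes in the front of `T`. -/
theorem exists_ncard_idleSources_le {K : Set (Σ m, Stack Voc ν ε X m)} (hK : K.Finite) :
    ∃ N, ∀ T : Graph Voc ν ε, T.front.length ∈ Sigma.fst '' K →
      (idleSources K T).Finite ∧ (idleSources K T).ncard ≤ N := by
  classical
  obtain ⟨M, hM⟩ := (hK.image Sigma.fst).bddAbove
  let B : Set (List ℕ) := {l | l.length ≤ M ∧ ∀ i ∈ l, i < M}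
  have hB : B.Finite := by
    refine ((List.finite_length_le (Fin M) M).image (List.map Fin.val)).subset ?_
    rintro l ⟨h, hl⟩
    refine ⟨l.attach.map fun i => ⟨i.1, hl _ i.2⟩, by simpa using h, by simp⟩
  refine ⟨(K ×ˢ B).ncard, fun T hT => ?_⟩
  let f : (Σ m, Stack Voc ν ε X m) × Graph Voc ν ε → (Σ m, Stack Voc ν ε X m) × List ℕ :=
    fun z => (z.1, z.2.front.map fun a => T.front.idxOf a)
  have hmaps : Set.MapsTo f (idleSources K T) (K ×ˢ B) := by
    rintro z ⟨h1, h2, h3⟩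
    refine ⟨h1, ?_, ?_⟩
    · simp only [f, List.length_map, h2]
      exact hM ⟨_, h1, rfl⟩
    · simp only [f, List.mem_map, forall_exists_index, and_imp, forall_apply_eq_imp_iff₂]
      exact fun a ha => (List.idxOf_lt_length_of_mem (h3.front_subset ha)).trans_le (hM hT)
  have hinj : Set.InjOn f (idleSources K T) := by
    -- Nodes, edges and rear are those of `T`; the front is recovered from the positions.
    rintro ⟨κ, G⟩ ⟨-, -, h⟩ ⟨κ', G'⟩ ⟨-, -, h'⟩ heq
    simp only [f, Prod.mk.injEq] at heq
    obtain ⟨rfl, hf⟩ := heq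
    have key : ∀ l : List ν, l ⊆ T.front →
        (l.map fun a => T.front.idxOf a).map (fun i => T.front[i]?) = l.map some := by
      intro l hl
      rw [List.map_map]
      exact List.map_congr_left fun a ha => List.getElem?_idxOf (hl ha)
    have hfr : G.front = G'.front := by
      have h1 := key _ h.front_subset
      rw [hf, key _ h'.front_subset] at h1
      exact (List.map_injective_iff.2 (Option.some_injective ν) h1).symm
    exact congrArg (Prod.mk κ) (Graph.ext (h.nodes_eq.symm.trans h'.nodes_eq)
      (h.inc_eq.symm.trans h'.inc_eq) hfr (h.rear_eq.symm.trans h'.rear_eq))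
  exact ⟨(hK.prod hB).of_injOn hmaps hinj,
    Set.ncard_le_ncard_of_injOn f hmaps hinj (hK.prod hB)⟩

/-- With a sufficiently large bound for the counter, counted steps lead as far as arbitrary ones:
between two steps that remove something, cycles can be left out. -/
theorem exists_counted [Infinite ν] {K : Set (Σ m, Stack Voc ν ε X m)} (hK : K.Finite)
    (hstep : ∀ x Γ y, Step x Γ y → x ∈ K → y ∈ K) :
    ∃ N, ∀ x y, x.1 ∈ K → x.2.front.length = x.1.1 → Relation.ReflTransGen Move x y →
      ∃ k, Relation.ReflTransGen (CountedMove N) (x, N) (y, k) := by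
  obtain ⟨N, hN⟩ := exists_ncard_idleSources_le hK
  refine ⟨N, fun x y hx hl h => ?_⟩
  have hmove : ∀ x y, Move x y → x.1 ∈ K → y.1 ∈ K :=
    fun x y ⟨Γ, h, _⟩ hx => hstep _ _ _ h hx
  have hinv : ∀ x y, Relation.ReflTransGen IdleMove x y → x.1 ∈ K →
      x.2.front.length = x.1.1 → y.1 ∈ K ∧ y.2.front.length = y.1.1 := by
    intro x y h hx hl
    induction h with
    | refl => exact ⟨hx, hl⟩
    | tail _ h ih => exact ⟨hmove _ _ h.move ih.1, h.move.typed⟩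
  have hidle : ∀ x y, x.1 ∈ K → x.2.front.length = x.1.1 → Relation.ReflTransGen IdleMove x y →
      ∃ k, Relation.ReflTransGen (CountedMove N) (x, N) (y, k) := by
    intro x y hx hl h
    obtain ⟨hy, hly⟩ := hinv x y h hx hl
    obtain ⟨hf, hc⟩ := hN y.2 ⟨y.1, hy, hly.symm⟩
    refine reflTransGen_countdown (R := IdleMove) ?_ N hf hc ?_
    · rintro a b k ⟨Γ, h, hc, -⟩
      exact ⟨Γ, h, hc, Or.inl rfl⟩
    · induction h using Relation.ReflTransGen.head_induction_on with
      | refl => exact .refl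
      | @head a b hab hby ih =>
        have hb : b.1 ∈ K := hmove _ _ hab.move hx
        have hlb := hab.move.typed
        exact .head ⟨hab, ⟨hx, hl, idle_of_reflTransGen (.head hab hby)⟩,
          ⟨hb, hlb, idle_of_reflTransGen hby⟩⟩ (ih hb hlb)
  -- A path is idle throughout, or it has a first step that removes something.
  have hsplit : Relation.ReflTransGen IdleMove x y ∨ ∃ a b k,
      Relation.ReflTransGen IdleMove x a ∧ (∀ k, CountedMove N (a, k) (b, N)) ∧
      Relation.ReflTransGen (CountedMove N) (b, N) (y, k) := by
    induction h using Relation.ReflTransGen.head_induction_on with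
    | refl => exact Or.inl .refl
    | @head x x₁ hx₁ _ ih =>
      have hK₁ := hmove _ _ hx₁ hx
      have hl₁ := hx₁.typed
      obtain ⟨Γ, h, hc⟩ := hx₁
      by_cases hΓ : Γ.Progress
      · right
        have : ∃ k, Relation.ReflTransGen (CountedMove N) (x₁, N) (y, k) := by
          rcases ih hK₁ hl₁ with h | ⟨a, b, k, h, hab, hby⟩
          · exact hidle _ _ hK₁ hl₁ h
          · obtain ⟨k', hk'⟩ := hidle _ _ hK₁ hl₁ h
            exact ⟨k, hk'.trans (.head (hab k') hby)⟩
        obtain ⟨k, hk⟩ := this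
        exact ⟨x, x₁, k, .refl, fun _ => ⟨Γ, h, hc, Or.inr ⟨hΓ, rfl⟩⟩, hk⟩
      · have hi : IdleMove x x₁ := ⟨Γ, h, hc, hΓ⟩
        exact (ih hK₁ hl₁).imp (fun h => .head hi h)
          fun ⟨a, b, k, h, hab⟩ => ⟨a, b, k, .head hi h, hab⟩
  rcases hsplit with h | ⟨a, b, k, h, hab, hby⟩
  · exact hidle _ _ hx hl h
  · obtain ⟨k', hk'⟩ := hidle _ _ hx hl h
    exact ⟨k, hk'.trans (.head (hab k') hby)⟩

end Stack

/-! ### From formula systems to automata -/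

/-- The formula `p` is universal under the sign `s`. -/
def Formula.UniversalAt {X : RankedSet.{z}} (p : Σ m, Formula Voc ν ε X m) (s : Sign) : Prop :=
  (s = Sign.pos ∧ p.2.Conjunctive) ∨ (s = Sign.neg ∧ ¬ p.2.Conjunctive)

/-- The states of the automaton for a formula system: a formula with a sign, or a stack of
expressions together with the kind of the quantifier that is being evaluated, its sign and a
counter. -/
inductive SystemState (Voc : RankedSet.{u}) (ν : Type v) (ε : Type w) (X : RankedSet.{z}) :
    Type (max u v w z)
  | main (p : Σ m, Formula Voc ν ε X m) (s : Sign)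
  | inter (κ : Σ m, Stack Voc ν ε X m) (univ : Prop) (s : Sign) (k : ℕ)

namespace SystemState

variable {X : RankedSet.{z}}

/-- The rank of a state. -/
def rank : SystemState Voc ν ε X → ℕ
  | main p _ => p.1
  | inter κ _ _ _ => κ.1

/-- The universal states. -/
def Universal : SystemState Voc ν ε X → Prop
  | main p s => Formula.UniversalAt p s
  | inter _ univ _ _ => univ

/-- The counter of a state; its value at the states without a counter does not matter. -/
def counter : SystemState Voc ν ε X → ℕ
  | main _ _ => 0
  | inter _ _ _ k => k

/-- The transitions between states, `N` being the bound for the counters. -/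
inductive Trans [Infinite ν] (F : FormulaSystem Voc ν ε X) (N : ℕ) :
    SystemState Voc ν ε X → Graph Voc ν ε → SystemState Voc ν ε X → Prop
  | neg {m : ℕ} (fo : Formula Voc ν ε X m) (s : Sign) :
      Trans F N (.main ⟨m, .neg fo⟩ s) (idGraph Voc ν ε m) (.main ⟨m, fo⟩ s.flip)
  | and_left {m : ℕ} (fo₁ fo₂ : Formula Voc ν ε X m) (s : Sign) :
      Trans F N (.main ⟨m, .and fo₁ fo₂⟩ s) (idGraph Voc ν ε m) (.main ⟨m, fo₁⟩ s)
  | and_right {m : ℕ} (fo₁ fo₂ : Formula Voc ν ε X m) (s : Sign) :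
      Trans F N (.main ⟨m, .and fo₁ fo₂⟩ s) (idGraph Voc ν ε m) (.main ⟨m, fo₂⟩ s)
  | or_left {m : ℕ} (fo₁ fo₂ : Formula Voc ν ε X m) (s : Sign) :
      Trans F N (.main ⟨m, .or fo₁ fo₂⟩ s) (idGraph Voc ν ε m) (.main ⟨m, fo₁⟩ s)
  | or_right {m : ℕ} (fo₁ fo₂ : Formula Voc ν ε X m) (s : Sign) :
      Trans F N (.main ⟨m, .or fo₁ fo₂⟩ s) (idGraph Voc ν ε m) (.main ⟨m, fo₂⟩ s)
  | var (x : X) (s : Sign) :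
      Trans F N (.main ⟨_, .var x rfl⟩ s) (idGraph Voc ν ε (X.rank x)) (.main ⟨_, F x⟩ s)
  | ex {m i : ℕ} (e : GraphExpr Voc ν ε m i) (fo : Formula Voc ν ε X i) (s : Sign) :
      Trans F N (.main ⟨m, .ex e fo⟩ s) (idGraph Voc ν ε m)
        (.inter ⟨m, .push e (.done fo)⟩ (Formula.UniversalAt ⟨m, .ex e fo⟩ s) s N)
  | all {m i : ℕ} (e : GraphExpr Voc ν ε m i) (fo : Formula Voc ν ε X i) (s : Sign) :
      Trans F N (.main ⟨m, .all e fo⟩ s) (idGraph Voc ν ε m)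
        (.inter ⟨m, .push e (.done fo)⟩ (Formula.UniversalAt ⟨m, .all e fo⟩ s) s N)
  | done {m : ℕ} (fo : Formula Voc ν ε X m) (univ : Prop) (s : Sign) (k : ℕ) :
      Trans F N (.inter ⟨m, .done fo⟩ univ s k) (idGraph Voc ν ε m) (.main ⟨m, fo⟩ s)
  | idle {κ κ' : Σ m, Stack Voc ν ε X m} {Γ : Graph Voc ν ε} (h : Stack.Step κ Γ κ')
      (univ : Prop) (s : Sign) (k : ℕ) :
      Trans F N (.inter κ univ s (k + 1)) Γ (.inter κ' univ s k)
  | progress {κ κ' : Σ m, Stack Voc ν ε X m} {Γ : Graph Voc ν ε} (h : Stack.Step κ Γ κ')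
      (hΓ : Γ.Progress) (univ : Prop) (s : Sign) (k : ℕ) :
      Trans F N (.inter κ univ s k) Γ (.inter κ' univ s N)

theorem Trans.hasType [Infinite ν] {F : FormulaSystem Voc ν ε X} {N : ℕ}
    {a b : SystemState Voc ν ε X} {Γ : Graph Voc ν ε} (h : Trans F N a Γ b) :
    Γ.HasType a.rank b.rank := by
  cases h with
  | idle h | progress h => exact h.hasType
  | _ => exact hasType_idGraph _

/-- The graphs on the transitions that leave a state form a finite set. -/
theorem Trans.finite_labels [Infinite ν] (F : FormulaSystem Voc ν ε X) (N : ℕ)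
    (a : SystemState Voc ν ε X) : {Γ | ∃ b, Trans F N a Γ b}.Finite := by
  have hstep : ∀ κ : Σ m, Stack Voc ν ε X m, {Γ | ∃ κ', Stack.Step κ Γ κ'}.Finite := by
    intro κ
    by_cases hκ : ∃ (m i : ℕ) (G : Graph Voc ν ε) (h : G.HasType m i) (κ' : Stack Voc ν ε X i),
        κ = ⟨m, .push (.graph G h) κ'⟩
    · obtain ⟨m, i, G, h, κ', rfl⟩ := hκ
      refine (Set.finite_singleton G).subset ?_
      rintro Γ ⟨κ'', h⟩
      cases h
      rfl
    · refine (Set.finite_singleton (idGraph Voc ν ε κ.1)).subset ?_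
      rintro Γ ⟨κ'', h⟩
      cases h with
      | graph _ h κ' => exact (hκ ⟨_, _, _, h, κ', rfl⟩).elim
      | _ => rfl
  cases a with
  | main p s =>
    refine (Set.finite_singleton (idGraph Voc ν ε p.1)).subset ?_
    rintro Γ ⟨b, h⟩
    cases h <;> rfl
  | inter κ univ s k =>
    refine ((hstep κ).insert (idGraph Voc ν ε κ.1)).subset ?_
    rintro Γ ⟨b, h⟩
    cases h with
    | done => exact Or.inl rfl
    | idle h | progress h => exact Or.inr ⟨_, h⟩

end SystemState

namespace FormulaSystem

variable {X : RankedSet.{z}} (F : FormulaSystem Voc ν ε X) (x : X)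

/-- The stacks that occur while the quantifier at the top of a formula is evaluated. -/
def quantStacks : {m : ℕ} → Formula Voc ν ε X m → Set (Σ m, Stack Voc ν ε X m)
  | _, .ex e fo => insert ⟨_, .done fo⟩ (Stack.states e (.done fo))
  | _, .all e fo => insert ⟨_, .done fo⟩ (Stack.states e (.done fo))
  | _, _ => ∅

/-- The stacks that occur while the quantifiers in the relevant formulas are evaluated. -/
def stackSet : Set (Σ m, Stack Voc ν ε X m) := ⋃ p ∈ F.relevant x, quantStacks p.2

theorem finite_stackSet : (F.stackSet x).Finite := by
  refine (F.finite_relevant x).biUnion fun p _ => ?_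
  obtain ⟨m, fo⟩ := p
  cases fo with
  | ex e fo | all e fo => exact (Stack.finite_states e _).insert _
  | _ => exact Set.finite_empty

theorem mem_stackSet_of_step [Infinite ν] (κ : Σ m, Stack Voc ν ε X m) (Γ : Graph Voc ν ε)
    (κ' : Σ m, Stack Voc ν ε X m) (h : Stack.Step κ Γ κ') (hκ : κ ∈ F.stackSet x) :
    κ' ∈ F.stackSet x := by
  obtain ⟨⟨m, fo⟩, hp, hκ⟩ := Set.mem_iUnion₂.1 hκ
  refine Set.mem_iUnion₂.2 ⟨⟨m, fo⟩, hp, ?_⟩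
  cases fo with
  | ex e fo | all e fo =>
    rcases hκ with rfl | hκ
    · cases h
    · exact h.mem_states hκ
  | _ => exact hκ.elim

theorem formula_mem_of_done_mem_stackSet {m : ℕ} {fo : Formula Voc ν ε X m}
    (h : ⟨m, .done fo⟩ ∈ F.stackSet x) : ⟨m, fo⟩ ∈ F.relevant x := by
  obtain ⟨⟨n, fo'⟩, hp, hκ⟩ := Set.mem_iUnion₂.1 h
  have key : ∀ {m i j : ℕ} (e : GraphExpr Voc ν ε i j) (κ : Stack Voc ν ε X j)
      (fo : Formula Voc ν ε X m), ⟨m, .done fo⟩ ∉ Stack.states e κ := by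
    intro m i j e
    have aux : ∀ {a b : ℕ} (e : GraphExpr Voc ν ε a b) (κ : Stack Voc ν ε X b)
        (fo : Formula Voc ν ε X m),
        (⟨m, .done fo⟩ : Σ m, Stack Voc ν ε X m) ≠ ⟨a, .push e κ⟩ := by
      intro a b e κ fo h
      cases h
    induction e with
    | empty | graph => exact fun κ fo h => aux _ _ _ h
    | union a b iha ihb | concat a b iha ihb =>
      exact fun κ fo h => h.elim (aux _ _ _) fun h => h.elim (iha _ _) (ihb _ _)
    | star a iha => exact fun κ fo h => h.elim (aux _ _ _) (iha _ _)
  have hs := succs_subset_relevant hp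
  cases fo' with
  | ex e fo' | all e fo' =>
    rcases hκ with hκ | hκ
    · cases hκ
      exact hs rfl
    · exact (key _ _ _ hκ).elim
  | _ => exact hκ.elim

/-- A bound for the counters that suffices for the stacks of `F`. -/
theorem exists_bound [Infinite ν] : ∃ N, ∀ x' y, x'.1 ∈ F.stackSet x →
    x'.2.front.length = x'.1.1 → Relation.ReflTransGen Stack.Move x' y →
      ∃ k, Relation.ReflTransGen (Stack.CountedMove N) (x', N) (y, k) :=
  Stack.exists_counted (F.finite_stackSet x) (F.mem_stackSet_of_step x)

/-- The bound for the counters. -/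
noncomputable def bound [Infinite ν] : ℕ := (F.exists_bound x).choose

/-- The states that are used. -/
def stateSet [Infinite ν] : Set (SystemState Voc ν ε X) :=
  {a | match a with
    | .main p _ => p ∈ F.relevant x
    | .inter κ _ _ k => κ ∈ F.stackSet x ∧ k ≤ F.bound x}

theorem finite_stateSet [Infinite ν] : (F.stateSet x).Finite := by
  have hs : (Set.univ : Set Sign).Finite :=
    (Set.toFinite {Sign.pos, Sign.neg}).subset fun s _ => by cases s <;> simp
  refine ((((F.finite_relevant x).prod hs).image fun t => SystemState.main t.1 t.2).union
    (((F.finite_stackSet x).prod ((Set.finite_univ (α := Prop)).prod (hs.prod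
      (Set.finite_Iic (F.bound x))))).image
        fun t => SystemState.inter t.1 t.2.1 t.2.2.1 t.2.2.2)).subset ?_
  rintro (⟨p, s⟩ | ⟨κ, univ, s, k⟩) h
  · exact Or.inl ⟨(p, s), ⟨h, trivial⟩, rfl⟩
  · exact Or.inr ⟨(κ, univ, s, k), ⟨h.1, trivial, trivial, h.2⟩, rfl⟩

theorem mem_stateSet_of_trans [Infinite ν] {a b : SystemState Voc ν ε X} {Γ : Graph Voc ν ε}
    (h : SystemState.Trans F (F.bound x) a Γ b) (ha : a ∈ F.stateSet x) : b ∈ F.stateSet x := by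
  cases h with
  | neg | var => exact succs_subset_relevant (p := ⟨_, _⟩) ha rfl
  | and_left | or_left => exact succs_subset_relevant (p := ⟨_, _⟩) ha (Or.inl rfl)
  | and_right | or_right => exact succs_subset_relevant (p := ⟨_, _⟩) ha (Or.inr rfl)
  | ex e fo s | all e fo s =>
    exact ⟨Set.mem_iUnion₂.2 ⟨_, ha, Or.inr (Stack.push_mem_states e _)⟩, le_rfl⟩
  | done fo univ s k => exact F.formula_mem_of_done_mem_stackSet x ha.1
  | idle h univ s k => exact ⟨F.mem_stackSet_of_step x _ _ _ h ha.1, (Nat.le_succ k).trans ha.2⟩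
  | progress h hΓ univ s k => exact ⟨F.mem_stackSet_of_step x _ _ _ h ha.1, le_rfl⟩

/-- An enumeration of the states; the index type is lifted to the required universe. -/
noncomputable def stateEquiv [Infinite ν] :
    ULift.{z} (Fin (Nat.card (F.stateSet x))) ≃ F.stateSet x :=
  have := (F.finite_stateSet x).to_subtype
  Equiv.ulift.trans (Finite.equivFin _).symm

/-- The automaton that evaluates `F` at `x`. -/
noncomputable def toAutomaton [Infinite ν] : GraphAutomaton.{u, v, w, z} Voc ν ε where
  Q :=
    { carrier := ULift.{z} (Fin (Nat.card (F.stateSet x)))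
      finite := inferInstance
      rank := fun q => (F.stateEquiv x q).1.rank }
  Δ := {t | SystemState.Trans F (F.bound x) (F.stateEquiv x t.1).1 t.2.1 (F.stateEquiv x t.2.2).1}
  finite := by
    have h := Set.finite_iUnion fun q =>
      SystemState.Trans.finite_labels F (F.bound x) (F.stateEquiv x q).1
    refine (Set.finite_univ.prod (h.prod Set.finite_univ)).subset ?_
    rintro ⟨q, Γ, r⟩ ht
    exact ⟨trivial, Set.mem_iUnion.2 ⟨q, _, ht⟩, trivial⟩
  typed := fun q Γ r h => SystemState.Trans.hasType h
  start := (F.stateEquiv x).symm ⟨.main ⟨_, .var x rfl⟩ .pos, Or.inl rfl⟩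
  universal := {q | (F.stateEquiv x q).1.Universal}

variable {F x}

/-- The state of a configuration, as a formula or a stack. -/
noncomputable def stateOf [Infinite ν] (n : (F.toAutomaton x).Config) : SystemState Voc ν ε X :=
  (F.stateEquiv x n.state).1

theorem step_toAutomaton_iff [Infinite ν] {n n' : (F.toAutomaton x).Config} :
    (F.toAutomaton x).Step n n' ↔ ∃ Γ, SystemState.Trans F (F.bound x) (stateOf n) Γ (stateOf n') ∧
      Cuts {P | Γ.Isomorphic P} n.graph n'.graph :=
  GraphAutomaton.step_iff _ _ _

theorem exists_step_toAutomaton [Infinite ν] (n : (F.toAutomaton x).Config)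
    {b : SystemState Voc ν ε X} {Γ T : Graph Voc ν ε}
    (h : SystemState.Trans F (F.bound x) (stateOf n) Γ b)
    (hT : Cuts {P | Γ.Isomorphic P} n.graph T) :
    ∃ n', stateOf n' = b ∧ n'.graph = T ∧ (F.toAutomaton x).Step n n' := by
  have hb : b ∈ F.stateSet x := F.mem_stateSet_of_trans x h (F.stateEquiv x n.state).2
  have hs : (F.stateEquiv x ((F.stateEquiv x).symm ⟨b, hb⟩)).1 = b :=
    congrArg Subtype.val ((F.stateEquiv x).apply_symm_apply _)
  have hr : T.front.length = b.rank :=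
    (hT.front_length fun P hP => Isomorphic.hasType hP h.hasType).2
  let n' : (F.toAutomaton x).Config :=
    ⟨(F.stateEquiv x).symm ⟨b, hb⟩, T, hr.trans (congrArg SystemState.rank hs).symm⟩
  have hn' : stateOf n' = b := hs
  exact ⟨n', hn', rfl, step_toAutomaton_iff.2 ⟨Γ, by rw [hn']; exact h, hT⟩⟩

/-- The formula configuration `c` is represented by the configuration `n` of the automaton. -/
def Represents [Infinite ν] (c : FormulaConfig Voc ν ε X) (n : (F.toAutomaton x).Config) : Prop :=
  stateOf n = .main ⟨c.arity, c.formula⟩ c.sign ∧ n.graph = c.graph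

/-- The configurations of the automaton between the one that represents `c` and those that represent
its successors: the stack describes nothing but steps from `c`. -/
def Processes [Infinite ν] (c : FormulaConfig Voc ν ε X) (d : (F.toAutomaton x).Config) : Prop :=
  ∃ κ k, stateOf d = .inter κ c.Universal c.sign k ∧
    ∀ p T, κ.2.Sem d.graph p T → ∃ c', F.Step c c' ∧ ⟨c'.arity, c'.formula⟩ = p ∧
      c'.sign = c.sign ∧ c'.graph = T

theorem Processes.step [Infinite ν] {c : FormulaConfig Voc ν ε X} {d d' : (F.toAutomaton x).Config}
    (hd : Processes c d) {Γ : Graph Voc ν ε} {κ κ' : Σ m, Stack Voc ν ε X m} {univ : Prop}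
    {s : Sign} {k k' : ℕ} (hs : stateOf d = .inter κ univ s k)
    (hs' : stateOf d' = .inter κ' univ s k') (h : Stack.Step κ Γ κ')
    (hc : Cuts {P | Γ.Isomorphic P} d.graph d'.graph) : Processes c d' := by
  obtain ⟨κ₀, k₀, h₀, hsem⟩ := hd
  rw [hs] at h₀
  cases h₀
  exact ⟨κ', k', hs', fun p T hT => hsem p T (h.sem hc hT)⟩

theorem represents_or_processes_of_step [Infinite ν] {c : FormulaConfig Voc ν ε X}
    {n n' : (F.toAutomaton x).Config} (hn : Represents c n) (h : (F.toAutomaton x).Step n n') :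
    Processes c n' ∨ ∃ c', F.Step c c' ∧ Represents c' n' := by
  obtain ⟨Γ, ht, hc⟩ := step_toAutomaton_iff.1 h
  obtain ⟨m, fo, G, s, hG⟩ := c
  obtain ⟨hn, rfl⟩ := hn
  rw [hn] at ht
  dsimp only at hn ht hG
  generalize hb : stateOf n' = b at ht
  cases ht with
  | neg fo => exact Or.inr ⟨_, .neg fo _ s hG, hb, (cuts_idGraph.1 hc).2⟩
  | and_left fo₁ fo₂ => exact Or.inr ⟨_, .and_left fo₁ fo₂ _ s hG, hb, (cuts_idGraph.1 hc).2⟩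
  | and_right fo₁ fo₂ => exact Or.inr ⟨_, .and_right fo₁ fo₂ _ s hG, hb, (cuts_idGraph.1 hc).2⟩
  | or_left fo₁ fo₂ => exact Or.inr ⟨_, .or_left fo₁ fo₂ _ s hG, hb, (cuts_idGraph.1 hc).2⟩
  | or_right fo₁ fo₂ => exact Or.inr ⟨_, .or_right fo₁ fo₂ _ s hG, hb, (cuts_idGraph.1 hc).2⟩
  | var y => exact Or.inr ⟨_, .var y rfl _ s hG hG, hb, (cuts_idGraph.1 hc).2⟩
  | ex e fo =>
    refine Or.inl ⟨_, _, hb, ?_⟩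
    rw [(cuts_idGraph.1 hc).2]
    rintro p T ⟨T₁, hT, rfl, rfl⟩
    have hl := (hT.front_length e.hasType_of_mem_lang).2
    obtain ⟨P, hP, hf, rfl⟩ := hT
    exact ⟨_, .ex e fo _ s hG P hP hf hl, rfl, rfl, rfl⟩
  | all e fo =>
    refine Or.inl ⟨_, _, hb, ?_⟩
    rw [(cuts_idGraph.1 hc).2]
    rintro p T ⟨T₁, hT, rfl, rfl⟩
    have hl := (hT.front_length e.hasType_of_mem_lang).2
    obtain ⟨P, hP, hf, rfl⟩ := hT
    exact ⟨_, .all e fo _ s hG P hP hf hl, rfl, rfl, rfl⟩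

theorem Processes.processes_or_represents_of_step [Infinite ν] {c : FormulaConfig Voc ν ε X}
    {d d' : (F.toAutomaton x).Config} (hd : Processes c d) (h : (F.toAutomaton x).Step d d') :
    Processes c d' ∨ ∃ c', F.Step c c' ∧ Represents c' d' := by
  obtain ⟨Γ, ht, hc⟩ := step_toAutomaton_iff.1 h
  obtain ⟨κ, k, hs, hsem⟩ := id hd
  rw [hs] at ht
  generalize hb : stateOf d' = b at ht
  cases ht with
  | done fo =>
    right
    obtain ⟨c', hc', hp, hs', hg⟩ := hsem _ _ ⟨rfl, rfl⟩
    exact ⟨c', hc', by rw [hb, hp, hs'], (cuts_idGraph.1 hc).2.trans hg.symm⟩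
  | idle hstep => exact Or.inl (hd.step hs hb hstep hc)
  | progress hstep => exact Or.inl (hd.step hs hb hstep hc)

theorem Processes.reach [Infinite ν] {c c' : FormulaConfig Voc ν ε X}
    {d : (F.toAutomaton x).Config} (hd : Processes c d)
    {a : ((Σ m, Stack Voc ν ε X m) × Graph Voc ν ε) × ℕ} {k' : ℕ}
    (hda : stateOf d = .inter a.1.1 c.Universal c.sign a.2) (hdT : d.graph = a.1.2)
    (hs : c'.sign = c.sign)
    (h : Relation.ReflTransGen (Stack.CountedMove (F.bound x)) a
      ((⟨c'.arity, .done c'.formula⟩, c'.graph), k')) :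
    ∃ n', Represents c' n' ∧ (F.toAutomaton x).evalGraph.Reach (Processes c) d n' := by
  induction h using Relation.ReflTransGen.head_induction_on generalizing d with
  | refl =>
    obtain ⟨n', hn', hg, he⟩ := exists_step_toAutomaton d (b := .main ⟨c'.arity, c'.formula⟩ c.sign)
      (by rw [hda]; exact .done c'.formula _ _ _) (cuts_idGraph.2 ⟨by rw [hdT]; exact c'.typed, rfl⟩)
    exact ⟨n', ⟨by rw [hn', hs], hg.trans hdT⟩, .edge he⟩
  | @head a a₁ h _ ih =>
    obtain ⟨⟨κ, T⟩, k⟩ := a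
    obtain ⟨⟨κ₁, T₁⟩, k₁⟩ := a₁
    obtain ⟨Γ, hstep, hc, hk⟩ := h
    have ht : SystemState.Trans F (F.bound x) (stateOf d) Γ (.inter κ₁ c.Universal c.sign k₁) := by
      rw [hda]
      rcases hk with rfl | ⟨hΓ, rfl⟩
      · exact .idle hstep _ _ _
      · exact .progress hstep hΓ _ _ _
    rw [← hdT] at hc
    obtain ⟨d₁, hd₁, hg, he⟩ := exists_step_toAutomaton d ht hc
    have hp : Processes c d₁ := hd.step hda hd₁ hstep (by rw [hg]; exact hc)
    obtain ⟨n', hn', hr⟩ := ih hp hd₁ hg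
    exact ⟨n', hn', .step he hp hr⟩

/-- Completeness: steps that keep the graph are single transitions, and those of a quantifier are
paths of elementary steps, which fit into the bound for the counter. -/
theorem Represents.exists_reach [Infinite ν] {c c' : FormulaConfig Voc ν ε X}
    {n : (F.toAutomaton x).Config} (hn : Represents c n) (h : F.Step c c') :
    ∃ n', Represents c' n' ∧ (F.toAutomaton x).evalGraph.Reach (Processes c) n n' := by
  have direct : ∀ {c c' : FormulaConfig Voc ν ε X} {n : (F.toAutomaton x).Config},
      Represents c n → SystemState.Trans F (F.bound x) (.main ⟨c.arity, c.formula⟩ c.sign)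
        (idGraph Voc ν ε c.arity) (.main ⟨c'.arity, c'.formula⟩ c'.sign) →
      c'.graph = c.graph →
      ∃ n', Represents c' n' ∧ (F.toAutomaton x).evalGraph.Reach (Processes c) n n' := by
    intro c c' n hn ht hg
    rw [← hn.1] at ht
    obtain ⟨n', hn', hg', he⟩ := exists_step_toAutomaton n ht
      (cuts_idGraph.2 ⟨by rw [hn.2]; exact c.typed, rfl⟩)
    exact ⟨n', ⟨hn', by rw [hg', hn.2, hg]⟩, .edge he⟩
  have quant : ∀ {m i : ℕ} {e : GraphExpr Voc ν ε m i} {fo : Formula Voc ν ε X i}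
      {c c' : FormulaConfig Voc ν ε X} {n : (F.toAutomaton x).Config}, Represents c n →
      SystemState.Trans F (F.bound x) (.main ⟨c.arity, c.formula⟩ c.sign)
        (idGraph Voc ν ε c.arity)
        (.inter ⟨m, .push e (.done fo)⟩ c.Universal c.sign (F.bound x)) →
      Cuts e.lang c.graph c'.graph → (⟨i, fo⟩ : Σ m, Formula Voc ν ε X m) =
        ⟨c'.arity, c'.formula⟩ → c'.sign = c.sign →
      ∃ n', Represents c' n' ∧ (F.toAutomaton x).evalGraph.Reach (Processes c) n n' := by
    intro m i e fo c c' n hn ht hc hp hs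
    rw [← hn.1] at ht
    obtain ⟨d, hd, hg, he⟩ := exists_step_toAutomaton n ht
      (cuts_idGraph.2 ⟨by rw [hn.2]; exact c.typed, rfl⟩)
    have hpd : Processes c d := by
      refine (represents_or_processes_of_step hn he).resolve_right ?_
      rintro ⟨c₁, -, h₁, -⟩
      rw [hd] at h₁
      cases h₁
    have hK : (⟨m, .push e (.done fo)⟩ : Σ m, Stack Voc ν ε X m) ∈ F.stackSet x := by
      have h₁ : stateOf d ∈ F.stateSet x := (F.stateEquiv x d.state).2
      rw [hd] at h₁
      exact h₁.1
    obtain ⟨k', hk'⟩ := (F.exists_bound x).choose_spec _ _ hK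
      (hc.front_length e.hasType_of_mem_lang).1 (Stack.reflTransGen_move e (.done fo) hc)
    have hfo : (⟨i, .done fo⟩ : Σ m, Stack Voc ν ε X m) = ⟨c'.arity, .done c'.formula⟩ := by
      obtain ⟨m', fo', G', s', h'⟩ := c'
      cases hp
      rfl
    rw [hfo] at hk'
    obtain ⟨n', hn', hr⟩ := hpd.reach hd (hg.trans hn.2) hs hk'
    exact ⟨n', hn', .step he hpd hr⟩
  cases h with
  | neg fo => exact direct hn (.neg fo _) rfl
  | and_left => exact direct hn (.and_left _ _ _) rfl
  | and_right => exact direct hn (.and_right _ _ _) rfl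
  | or_left => exact direct hn (.or_left _ _ _) rfl
  | or_right => exact direct hn (.or_right _ _ _) rfl
  | var y hy G s h h' =>
    subst hy
    exact direct hn (.var y s) rfl
  | ex e fo G s h P hP hf h' => exact quant hn (.ex e fo s) ⟨P, hP, hf, rfl⟩ rfl rfl
  | all e fo G s h P hP hf h' => exact quant hn (.all e fo s) ⟨P, hP, hf, rfl⟩ rfl rfl

variable (F x)

/-- Intermediate configurations terminate because every step removes something or lowers the
counter. -/
theorem refines_toAutomaton [Infinite ν] :
    EvalGraph.Refines F.evalGraph (F.toAutomaton x).evalGraph Represents Processes where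
  kind := by
    rintro c d (hd | ⟨κ, k, hd, -⟩)
    · left
      change (stateOf d).Universal ↔ c.Universal
      rw [hd.1]
      exact Iff.rfl
    · left
      change (stateOf d).Universal ↔ c.Universal
      rw [hd]
      exact Iff.rfl
  sound := fun c d d' hd he =>
    hd.elim (fun h => represents_or_processes_of_step h he)
      fun h => h.processes_or_represents_of_step he
  complete := fun c c' n hn he => hn.exists_reach he
  wf := by
    refine Subrelation.wf ?_ (InvImage.wf
      (fun d : (F.toAutomaton x).Config => (d.graph.weight, (stateOf d).counter))
      (WellFounded.prod_lex Nat.lt_wfRel.wf Nat.lt_wfRel.wf))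
    rintro d' d ⟨he, c, ⟨κ, k, hd, -⟩, κ', k', hd', -⟩
    obtain ⟨Γ, ht, P, hP, hf, hT⟩ := step_toAutomaton_iff.1 he
    refine Prod.lex_def.2 ?_
    change d'.graph.weight < d.graph.weight ∨ d'.graph.weight = d.graph.weight ∧
      (stateOf d').counter < (stateOf d).counter
    rw [hT]
    rw [hd, hd'] at ht ⊢
    cases ht with
    | idle h =>
      exact (weight_cut_le hf).lt_or_eq.imp_right fun h => ⟨h, Nat.lt_succ_self _⟩
    | progress h hΓ => exact Or.inl (weight_cut_lt hf ((Isomorphic.progress_iff hP).2 hΓ))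

theorem rank_start_toAutomaton [Infinite ν] :
    (F.toAutomaton x).Q.rank (F.toAutomaton x).start = X.rank x :=
  congrArg (fun a => a.1.rank) ((F.stateEquiv x).apply_symm_apply
    ⟨.main ⟨_, .var x rfl⟩ .pos, Or.inl rfl⟩)

theorem toAutomaton_languages [Infinite ν] :
    F.lowerLanguage x = (F.toAutomaton x).lowerLanguage ∧
      F.upperLanguage x = (F.toAutomaton x).upperLanguage :=
  F.languages_eq x _ (F.rank_start_toAutomaton x).symm fun G h h' b =>
    (F.refines_toAutomaton x).val_iff (c := initialConfig x G h)
      (n := ⟨(F.toAutomaton x).start, G, h'⟩)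
      ⟨congrArg Subtype.val ((F.stateEquiv x).apply_symm_apply _), rfl⟩ b

end FormulaSystem
end GraphForm

theorem mainTheorem1 (Voc : RankedSet.{u}) (ν : Type v) (ε : Type w)
    [Infinite ν] [Infinite ε] :
    (∀ A : GraphAutomaton.{u, v, w, z} Voc ν ε,
      ∃ (X : RankedSet.{z}) (F : FormulaSystem Voc ν ε X) (x : X),
        X.rank x = A.Q.rank A.start ∧
        F.lowerLanguage x = A.lowerLanguage ∧ F.upperLanguage x = A.upperLanguage) ∧
    (∀ (X : RankedSet.{z}) (F : FormulaSystem Voc ν ε X) (x : X),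
      ∃ A : GraphAutomaton.{u, v, w, z} Voc ν ε,
        A.Q.rank A.start = X.rank x ∧
        A.lowerLanguage = F.lowerLanguage x ∧ A.upperLanguage = F.upperLanguage x) := by
  refine ⟨fun A => ⟨A.Q, A.toFormulaSystem, A.start, rfl, A.toFormulaSystem_languages⟩,
    fun X F x => ⟨F.toAutomaton x, F.rank_start_toAutomaton x, ?_⟩⟩
  exact ⟨(F.toAutomaton_languages x).1.symm, (F.toAutomaton_languages x).2.symm⟩
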